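/- A \emph{signature} $\mathcal C=(\Sigma,\mathrm{type})$ is a finite set $\Sigma$ of labels with a function $\mathrm{type}:\Sigma\to\mathbb N$. A \emph{hypergraph} over $\mathcal C$ has finite sets $V$ of nodes and $E$ of hyperedges, a label $\mathrm{lab}(e)\in\Sigma$ and an attachment sequence $\mathrm{att}(e)\in V^{*}$ of length $\mathrm{type}(\mathrm{lab}(e))$ for each $e\in E$, and a sequence $\mathrm{ext}\in V^{*}$ of external nodes, whose length is the type of the hypergraph (repetitions are allowed). Isomorphisms preserve all of this. The \emph{handle} $X^{\bullet}$ of a label $X$ of type $n$ has nodes $v_1,\dots,v_n$ and one hyperedge labelled $X$, with $\mathrm{att}=\mathrm{ext}=v_1\cdots v_n$. The \emph{string graph} $w^{\bullet}$ of a string $w=x_1\cdots x_n$ of labels of type $2$ has nodes $v_0,\dots,v_n$, hyperedges $e_1,\dots,e_n$ with $\mathrm{lab}(e_i)=x_i$ and $\mathrm{att}(e_i)=v_{i-1}v_i$, and $\mathrm{ext}=v_0v_n$; any hypergraph isomorphic to $w^{\bullet}$ is a string graph representing $w$. For a set $L$ of hypergraphs, $\mathrm{STR}(L)$ is the set of strings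 represented by the string graphs in $L$; $L$ is a \emph{string graph language} if all its members are string graphs. A \emph{table} is a finite set $T$ of pairs (rules) $(X,R)$ of a label $X$ and a hypergraph $R$ of type $\mathrm{type}(X)$, with at least one rule for every $X\in\Sigma$. Write $H\Rrightarrow_T H'$ if $H'$ is, up to isomorphism, obtained from $H$ by replacing simultaneously every hyperedge $e$ by (a fresh copy of) some $R_e$ with $(\mathrm{lab}(e),R_e)\in T$, identifying the $i$-th external node of $R_e$ with the $i$-th attachment node of $e$ for all $i$, and keeping the external nodes of $H$. A \emph{PHR grammar} $\mathcal G=(\mathcal C,A,S,\mathcal T)$ consists of a signature, a set $A\subseteq\Sigma$ of terminal labels, a start symbol $S\in\Sigma$ and a non-empty finite set $\mathcal T$ of tables. Its language $\mathrm L(\mathcal G)$ is the set of all hypergraphs with all labels in $A$ that are isomorphic to $S^{\bullet}$ or obtained from $S^{\bullet}$ by finitely many steps $\Rrightarrow_T$ with $T\in\mathcal T$. It is a $(k,l)$-PHR grammar if all its rules have type at most $k$ and $|\mathcal T|\le l$. A string language $L$ over a finite alphabet belongs to $\mathcal{PHRS}$ if for some $k\ge 2$, $l\ge 1$ there is a $(k,l)$-PHR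 grammar $\mathcal G$ such that $\mathrm L(\mathcal G)$ is a string graph language and $\mathrm{STR}(\mathrm L(\mathcal G))=L\setminus\{\epsilon\}$. $\mathcal{REC}$ denotes the family of recursive (decidable) string languages over finite alphabets. \textbf{Theorem} (Decidable PHRS Membership). There is an algorithm that, given (a finite description of) a PHR grammar $\mathcal G$ such that $\mathrm L(\mathcal G)$ is a string graph language, and a string $w$ of labels of $\mathcal G$ (in particular, any string $w\in A^{*}$ of terminals), decides whether $w\in\mathrm{STR}(\mathrm L(\mathcal G))$. Moreover $\mathcal{PHRS}\subsetneq\mathcal{REC}$. -/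

import Mathlib

/-- A signature: a finite set of labels, each with an arity, called its type. -/
structure Signature where
  Label : Type
  finite_label : Finite Label
  type : Label → ℕ

/-- A finite labelled hypergraph over the signature `C`. Each hyperedge is attached to a sequence of
nodes whose length is the type of its label; `ext` is the sequence of external nodes. -/
structure LabHypergraph (C : Signature) where
  V : Type
  E : Type
  finite_V : Finite V
  finite_E : Finite E
  att : E → List V
  lab : E → C.Label
  ext : List V
  length_att : ∀ e, (att e).length = C.type (lab e)

namespace LabHypergraph

variable {C : Signature}

/-- The type of a hypergraph. -/
def type (H : LabHypergraph C) : ℕ := H.ext.length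

/-- `G ≅ H`: there is a bijective morphism that maps the external nodes of `G` exactly to those
of `H`. -/
def Isomorphic (G H : LabHypergraph C) : Prop :=
  ∃ (gV : G.V ≃ H.V) (gE : G.E ≃ H.E),
    (∀ e, H.att (gE e) = (G.att e).map gV) ∧
    (∀ e, H.lab (gE e) = G.lab e) ∧
    H.ext = G.ext.map gV

/-- The handle `X^•` of a label `X`: one hyperedge labelled `X`, attached to pairwise distinct
nodes, which are the external nodes in the same order. -/
def handle (X : C.Label) : LabHypergraph C where
  V := Fin (C.type X)
  E := Unit
  finite_V := inferInstance
  finite_E := inferInstance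
  att _ := List.finRange (C.type X)
  lab _ := X
  ext := List.finRange (C.type X)
  length_att _ := List.length_finRange

/-- The string graph `w^•` of a string `w` of labels of type `2`: a path from the first to the
second external node whose hyperedges carry the letters of `w`. -/
def stringGraph (w : List C.Label) (hw : ∀ a ∈ w, C.type a = 2) : LabHypergraph C where
  V := Fin (w.length + 1)
  E := Fin w.length
  finite_V := inferInstance
  finite_E := inferInstance
  att i := [i.castSucc, i.succ]
  lab i := w.get i
  ext := [0, Fin.last w.length]
  length_att i := (hw _ (w.get_mem i)).symm

/-- `H` is a string graph representing `w`. -/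
def Represents (H : LabHypergraph C) (w : List C.Label) : Prop :=
  ∃ hw : ∀ a ∈ w, C.type a = 2, H.Isomorphic (stringGraph w hw)

/-- The identifications made when every hyperedge `e` of `H` is replaced by `σ e`: the `i`-th
attachment node of `e` is identified with the `i`-th external node of `σ e`. -/
inductive Glue (H : LabHypergraph C) (σ : H.E → LabHypergraph C) :
    H.V ⊕ (Σ e, (σ e).V) → H.V ⊕ (Σ e, (σ e).V) → Prop
  | mk (e : H.E) (i : ℕ) (v : H.V) (u : (σ e).V)
      (hv : (H.att e)[i]? = some v) (hu : (σ e).ext[i]? = some u) :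
      Glue H σ (Sum.inl v) (Sum.inr ⟨e, u⟩)

/-- The replacement `H[e₁/σ(e₁), …, eₙ/σ(eₙ)]` of all hyperedges `e₁, …, eₙ` of `H`. The node set
is the quotient of the disjoint union by the equivalence relation that `Glue` generates. -/
def replaceAll (H : LabHypergraph C) (σ : H.E → LabHypergraph C) : LabHypergraph C where
  V := Quot (Glue H σ)
  E := Σ e, (σ e).E
  finite_V :=
    haveI := H.finite_V
    haveI := H.finite_E
    haveI := fun e => (σ e).finite_V
    inferInstance
  finite_E :=
    haveI := H.finite_E
    haveI := fun e => (σ e).finite_E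
    inferInstance
  att x := ((σ x.1).att x.2).map fun u => Quot.mk _ (Sum.inr ⟨x.1, u⟩)
  lab x := (σ x.1).lab x.2
  ext := H.ext.map fun v => Quot.mk _ (Sum.inl v)
  length_att x := by simpa using (σ x.1).length_att x.2

end LabHypergraph

/-- A table: a finite set of rules `(L, R)` with `type L = type R` in which every label occurs as a
left-hand side. -/
structure IsTable {C : Signature} (T : Set (C.Label × LabHypergraph C)) : Prop where
  finite : T.Finite
  type_eq : ∀ r ∈ T, r.2.type = C.type r.1
  total : ∀ L : C.Label, ∃ R : LabHypergraph C, (L, R) ∈ T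

/-- The parallel direct derivation relation of a table: every hyperedge is replaced. -/
def DirectlyDerives {C : Signature} (T : Set (C.Label × LabHypergraph C))
    (H H' : LabHypergraph C) : Prop :=
  ∃ σ : H.E → LabHypergraph C, (∀ e, (H.lab e, σ e) ∈ T) ∧ H'.Isomorphic (H.replaceAll σ)

/-- A parallel hyperedge replacement grammar over the signature `C`. -/
structure PHRGrammar (C : Signature) where
  terminals : Set C.Label
  start : C.Label
  tables : Set (Set (C.Label × LabHypergraph C))
  finite_tables : tables.Finite
  nonempty_tables : tables.Nonempty
  isTable : ∀ T ∈ tables, IsTable T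

/-- `STR(L)`, the set of strings represented by the string graphs in `L`. -/
def STR {C : Signature} (L : Set (LabHypergraph C)) : Set (List C.Label) :=
  {w | ∃ H ∈ L, H.Represents w}

/-- A string graph language contains only string graphs. -/
def IsStringGraphLanguage {C : Signature} (L : Set (LabHypergraph C)) : Prop :=
  ∀ H ∈ L, ∃ w, H.Represents w

namespace PHRGrammar

variable {C : Signature}

/-- Parallel derivation: a nonempty sequence of parallel direct derivations by tables of the
grammar, or an isomorphism. -/
def Derives (G : PHRGrammar C) (H H' : LabHypergraph C) : Prop :=
  H.Isomorphic H' ∨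
    Relation.TransGen (fun H₁ H₂ => ∃ T ∈ G.tables, DirectlyDerives T H₁ H₂) H H'

/-- The hypergraph language generated by the grammar. -/
def language (G : PHRGrammar C) : Set (LabHypergraph C) :=
  {H | G.Derives (LabHypergraph.handle G.start) H ∧ ∀ e, H.lab e ∈ G.terminals}

/-- The grammar is of order `k` and uses at most `l` tables. -/
def IsOfOrder (G : PHRGrammar C) (k l : ℕ) : Prop :=
  (∀ T ∈ G.tables, ∀ r ∈ T, r.2.type ≤ k) ∧ G.tables.encard ≤ l

end PHRGrammar

/-- A string language over a finite alphabet. -/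
structure StringLanguage where
  Alphabet : Type
  finite_alphabet : Finite Alphabet
  lang : Language Alphabet

/-- The parallel hyperedge replacement string languages of order `k` with at most `l` tables:
some `(k, l)`-PHR grammar generates a string graph language that represents exactly the nonempty
strings of `L`, its alphabet being viewed as a set of labels. -/
def PHRSkl (k l : ℕ) : Set StringLanguage :=
  {L | ∃ (C : Signature) (G : PHRGrammar C) (ι : L.Alphabet ↪ C.Label),
    G.IsOfOrder k l ∧ IsStringGraphLanguage G.language ∧
    STR G.language = List.map ι '' {w | w ∈ L.lang ∧ w ≠ []}}

/-- The family of parallel hyperedge replacement string languages. -/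
def PHRS : Set StringLanguage := {L | ∃ k l : ℕ, 2 ≤ k ∧ 1 ≤ l ∧ L ∈ PHRSkl k l}

/-- The family of recursive string languages (with respect to a numbering of the alphabet). -/
def REC : Set StringLanguage :=
  {L | ∃ (n : ℕ) (e : L.Alphabet ≃ Fin n),
    ComputablePred fun w : List (Fin n) => w.map e.symm ∈ L.lang}

/-- Finite data for a hypergraph: the number of nodes, the list of hyperedges, each with the number
of its label and the numbers of its attachment nodes, and the list of external nodes. -/
abbrev HypergraphCode := ℕ × List (ℕ × List ℕ) × List ℕ

/-- Finite data for a rule: the number of the left-hand side and the right-hand side. -/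
abbrev RuleCode := ℕ × HypergraphCode

/-- Finite data for a grammar: the list of the types of the labels, the list of terminal labels, the
start symbol, and the list of tables, each a list of rules. -/
abbrev GrammarCode := List ℕ × List ℕ × ℕ × List (List RuleCode)

/-- The list `cs` consists of descriptions, in the sense of `R`, of exactly the elements of `S`. -/
def DescribesSet {γ : Type*} {β : Type*} (R : γ → β → Prop) (cs : List γ) (S : Set β) : Prop :=
  (∀ c ∈ cs, ∃ b ∈ S, R c b) ∧ ∀ b ∈ S, ∃ c ∈ cs, R c b

/-- `(m, es, x)` describes the hypergraph `H`, with labels numbered by `ν` and for some numbering of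
the nodes and hyperedges. -/
def HypergraphCode.Describes {C : Signature} {n : ℕ} (ν : C.Label ≃ Fin n) :
    HypergraphCode → LabHypergraph C → Prop
  | (m, es, x), H => ∃ (v : H.V ≃ Fin m) (e : H.E ≃ Fin es.length),
      (∀ y, es.get (e y) = ((ν (H.lab y) : ℕ), (H.att y).map fun u => (v u : ℕ))) ∧
      x = H.ext.map fun u => (v u : ℕ)

/-- `c` describes the rule `r`, with labels numbered by `ν`. -/
def RuleCode.Describes {C : Signature} {n : ℕ} (ν : C.Label ≃ Fin n)
    (c : RuleCode) (r : C.Label × LabHypergraph C) : Prop :=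
  c.1 = (ν r.1 : ℕ) ∧ HypergraphCode.Describes ν c.2 r.2

/-- `(ts, as, s, tabs)` describes the grammar `G`, with labels numbered by `ν`. -/
def GrammarCode.Describes {C : Signature} {n : ℕ} (ν : C.Label ≃ Fin n) :
    GrammarCode → PHRGrammar C → Prop
  | (ts, as, s, tabs), G =>
      ts = List.ofFn (fun i => C.type (ν.symm i)) ∧
      DescribesSet (fun (a : ℕ) (X : C.Label) => a = ν X) as G.terminals ∧
      s = ν G.start ∧
      DescribesSet (DescribesSet (RuleCode.Describes ν)) tabs G.tables

theorem DescribesSet.exists_of_finite {γ : Type*} {β : Type*} [Nonempty γ]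
    {R : γ → β → Prop} {S : Set β} (hS : S.Finite) (h : ∀ b ∈ S, ∃ c, R c b) :
    ∃ cs, DescribesSet R cs S := by
  choose! f hf using h
  refine ⟨hS.toFinset.toList.map f, ?_, fun b hb => ⟨f b, ?_, hf b hb⟩⟩
  · intro c hc
    obtain ⟨b, hb, rfl⟩ := List.mem_map.1 hc
    have hb' : b ∈ S := by simpa using hb
    exact ⟨b, hb', hf b hb'⟩
  · exact List.mem_map.2 ⟨b, by simpa using hb, rfl⟩

/-- Every grammar has a description, for every numbering of its labels. -/
theorem GrammarCode.exists_describes {C : Signature} {n : ℕ} (ν : C.Label ≃ Fin n)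
    (G : PHRGrammar C) : ∃ c : GrammarCode, c.Describes ν G := by
  have hfin := C.finite_label
  obtain ⟨as, has⟩ := DescribesSet.exists_of_finite (R := fun (a : ℕ) (X : C.Label) => a = ν X)
    (Set.toFinite G.terminals) fun X _ => ⟨_, rfl⟩
  obtain ⟨tabs, htabs⟩ := DescribesSet.exists_of_finite (R := DescribesSet (RuleCode.Describes ν))
    G.finite_tables fun T hT => DescribesSet.exists_of_finite (G.isTable T hT).finite fun r _ => by
      have := r.2.finite_V
      have := r.2.finite_E
      obtain ⟨m, ⟨v⟩⟩ := Finite.exists_equiv_fin r.2.V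
      obtain ⟨k, ⟨e⟩⟩ := Finite.exists_equiv_fin r.2.E
      refine ⟨(ν r.1, m, List.ofFn (fun j => ((ν (r.2.lab (e.symm j)) : ℕ),
        (r.2.att (e.symm j)).map fun u => (v u : ℕ))), r.2.ext.map fun u => (v u : ℕ)), rfl,
        v, e.trans (finCongr (List.length_ofFn).symm), fun y => ?_, rfl⟩
      simp
  exact ⟨(_, as, _, tabs), rfl, has, rfl, htabs⟩

/-! Rules may delete hyperedges and merge nodes, so a derivation can pass through hypergraphs much
larger than its result, and the size of the result does not directly limit the number of steps. The
limit comes from context-freeness and the pigeonhole principle.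

Hyperedges derive independently of each other (`derivesIn_iff`, which rests on associativity of
replacement). So what a label yields under `T :: τ` arises from a `T`-rule for that label by filling
every hyperedge with something its label yields under `τ`. If the result has at most `b` internal
nodes and at most `b` hyperedges, so has every filling (`Small.of_replaceAll`). Hence the family,
indexed by the labels, of small hypergraphs yielded under `T :: τ` depends only on `T` and on the
family for `τ` (`smallYield_cons_eq`). Up to isomorphism there are finitely many such families. If
two suffixes of a table sequence have the same family, the segment between them can be cut out
(`exists_short_list`). So a derivable string graph has a derivation of computably bounded length
(`exists_short_derivation`).

Membership thus becomes a bounded search over all short derivations. Quotients of node sets are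
never computed: a step only records which names are to be identified, and the final test against a
string graph resolves the identifications by quantifying over finitely many maps on names
(`isString_iff`). The search is primitive recursive and uniform in the grammar, whence `PHRS ⊆ REC`.
Diagonalising against it over a one-letter alphabet gives a recursive language that no grammar
generates. -/

theorem List.getElem?_map_of {α β : Type*} (f : α → β) {l : List α} {i : ℕ} {a : α}
    (h : l[i]? = some a) : (l.map f)[i]? = some (f a) := by
  simp [h]

theorem List.exists_of_getElem?_map {α β : Type*} {f : α → β} {l : List α} {i : ℕ} {b : β}
    (h : (l.map f)[i]? = some b) : ∃ a, l[i]? = some a ∧ f a = b := by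
  simpa using h

theorem List.finRange_getElem?_val {n : ℕ} (i : Fin n) : (List.finRange n)[i.1]? = some i := by
  simp

theorem List.getElem?_finCast {α : Type*} {l : List α} {n : ℕ} (h : n = l.length) (i : Fin n) :
    l[i.1]? = some (l.get (Fin.cast h i)) := by
  subst h
  simp

theorem List.val_finRange_getElem {n i : ℕ} (h : i < (List.finRange n).length) :
    i = ((List.finRange n)[i]).1 := by
  simp

theorem List.val_of_finRange_getElem? {n i : ℕ} {j : Fin n}
    (h : (List.finRange n)[i]? = some j) : j.1 = i := by
  obtain ⟨hi, rfl⟩ := List.getElem?_eq_some_iff.1 h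
  simp

/-! ### Isomorphism and the algebra of hyperedge replacement -/

namespace LabHypergraph

variable {C : Signature}

theorem Isomorphic.refl (H : LabHypergraph C) : H.Isomorphic H :=
  ⟨Equiv.refl _, Equiv.refl _, by simp, by simp, by simp⟩

theorem Isomorphic.symm {G H : LabHypergraph C} (h : G.Isomorphic H) : H.Isomorphic G := by
  obtain ⟨gV, gE, h1, h2, h3⟩ := h
  refine ⟨gV.symm, gE.symm, fun e => ?_, fun e => ?_, ?_⟩
  · have := h1 (gE.symm e)
    simp at this
    simp [this]
  · have := h2 (gE.symm e)
    simp at this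
    simp [this]
  · simp [h3]

theorem Isomorphic.trans {G H K : LabHypergraph C} (h : G.Isomorphic H) (h' : H.Isomorphic K) :
    G.Isomorphic K := by
  obtain ⟨gV, gE, h1, h2, h3⟩ := h
  obtain ⟨kV, kE, k1, k2, k3⟩ := h'
  exact ⟨gV.trans kV, gE.trans kE, by simp [h1, k1], by simp [h2, k2], by simp [h3, k3]⟩

/-- Isomorphic hypergraphs with isomorphic replacements have isomorphic results. -/
theorem replaceAll_congr {H H' : LabHypergraph C} (gV : H.V ≃ H'.V) (gE : H.E ≃ H'.E)
    (hatt : ∀ e, H'.att (gE e) = (H.att e).map gV) (hext : H'.ext = H.ext.map gV)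
    {σ : H.E → LabHypergraph C} {σ' : H'.E → LabHypergraph C}
    (h : ∀ e, (σ e).Isomorphic (σ' (gE e))) :
    (H.replaceAll σ).Isomorphic (H'.replaceAll σ') := by
  choose fV fE f1 f2 f3 using h
  let q : (H.V ⊕ Σ e, (σ e).V) ≃ (H'.V ⊕ Σ e, (σ' e).V) :=
    Equiv.sumCongr gV (Equiv.sigmaCongr gE fV)
  have hq : ∀ a b, Glue H σ a b ↔ Glue H' σ' (q a) (q b) := by
    intro a b
    constructor
    · rintro ⟨e, i, v, u, hv, hu⟩
      refine Glue.mk (gE e) i (gV v) (fV e u) ?_ ?_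
      · rw [hatt, List.getElem?_map, hv]; rfl
      · rw [f3, List.getElem?_map, hu]; rfl
    · intro hg
      rcases a with v | ⟨e, u⟩
      · rcases b with v' | ⟨e, u⟩
        · cases hg
        · have : ∀ (x y), Glue H' σ' x y → x = Sum.inl (gV v) → y = Sum.inr ⟨gE e, fV e u⟩ →
              Glue H σ (Sum.inl v) (Sum.inr ⟨e, u⟩) := by
            rintro _ _ ⟨e', i, v', u', hv, hu⟩ hx hy
            cases hx
            cases hy
            refine Glue.mk e i v u ?_ ?_
            · rw [hatt, List.getElem?_map] at hv
              simpa using hv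
            · rw [f3, List.getElem?_map] at hu
              simpa using hu
          exact this _ _ hg rfl rfl
      · cases hg
  refine ⟨Quot.congr q hq, Equiv.sigmaCongr gE fE, ?_, ?_, ?_⟩
  · rintro ⟨e, x⟩
    refine (congrArg (List.map _) (f1 e x)).trans ?_
    refine List.map_map.trans (Eq.trans ?_ List.map_map.symm)
    rfl
  · rintro ⟨e, x⟩
    exact f2 e x
  · simp only [replaceAll, hext, List.map_map]
    rfl

theorem replaceAll_congr_right {H : LabHypergraph C} {σ σ' : H.E → LabHypergraph C}
    (h : ∀ e, (σ e).Isomorphic (σ' e)) : (H.replaceAll σ).Isomorphic (H.replaceAll σ') :=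
  replaceAll_congr (Equiv.refl _) (Equiv.refl _) (by simp) (by simp) h

/-- Replacing every hyperedge by the handle of its label changes nothing. -/
theorem replaceAll_handle (H : LabHypergraph C) :
    (H.replaceAll fun e => handle (H.lab e)).Isomorphic H := by
  let f : (H.V ⊕ Σ e : H.E, (handle (H.lab e)).V) → H.V :=
    Sum.elim id fun x => (H.att x.1).get (Fin.cast (H.length_att x.1).symm x.2)
  have hf : ∀ a b, Glue H (fun e => handle (H.lab e)) a b → f a = f b := by
    rintro _ _ ⟨e, i, v, u, hv, hu⟩
    change v = (H.att e).get _
    have hu' := List.val_of_finRange_getElem? hu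
    obtain ⟨hi, rfl⟩ := List.getElem?_eq_some_iff.1 hv
    subst hu'
    rfl
  have hinr : ∀ x : (Σ e : H.E, (handle (H.lab e)).V),
      Quot.mk (Glue H fun e => handle (H.lab e)) (Sum.inl (f (Sum.inr x))) =
        Quot.mk _ (Sum.inr x) := by
    rintro ⟨e, i⟩
    exact Quot.sound (Glue.mk e i.1 _ _ (List.getElem?_finCast _ i) (List.finRange_getElem?_val i))
  let q : Quot (Glue H fun e => handle (H.lab e)) ≃ H.V :=
    { toFun := Quot.lift f hf
      invFun := fun v => Quot.mk _ (Sum.inl v)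
      left_inv := by
        rintro ⟨v | x⟩
        · rfl
        · exact hinr x
      right_inv := fun v => rfl }
  refine ⟨q, Equiv.sigmaPUnit H.E, ?_, ?_, ?_⟩
  · rintro ⟨e, x⟩
    refine Eq.trans ?_ List.map_map.symm
    refine List.ext_getElem ?_ ?_
    · exact (H.length_att e).trans (by rw [List.length_map]; exact List.length_finRange.symm)
    · intro i h1 h2
      rw [List.getElem_map]
      change (H.att e)[i] = (H.att e).get _
      rw [List.get_eq_getElem]
      congr 1
      exact (List.val_finRange_getElem (n := C.type (H.lab e)) (i := i)
        (by rw [List.length_finRange, ← H.length_att]; exact h1)).trans rfl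
  · rintro ⟨e, x⟩
    rfl
  · refine Eq.trans ?_ List.map_map.symm
    exact (List.map_id _).symm

/-- Replacing the hyperedge of a handle by `σ` gives `σ`. -/
theorem handle_replaceAll (X : C.Label) (σ : (handle X).E → LabHypergraph C)
    (hσ : (σ ()).type = C.type X) : ((handle X).replaceAll σ).Isomorphic (σ ()) := by
  have hlen : C.type X = (σ ()).ext.length := hσ.symm
  let f : ((handle X).V ⊕ Σ e : (handle X).E, (σ e).V) → (σ ()).V :=
    Sum.elim (fun i => (σ ()).ext.get (Fin.cast hlen i)) fun x => x.2
  have hf : ∀ a b, Glue (handle X) σ a b → f a = f b := by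
    rintro _ _ ⟨e, i, v, u, hv, hu⟩
    change (σ ()).ext.get _ = u
    have hv' := List.val_of_finRange_getElem? hv
    subst hv'
    obtain ⟨hi', rfl⟩ := List.getElem?_eq_some_iff.1 hu
    rfl
  have hinl : ∀ i : Fin (C.type X), Quot.mk (Glue (handle X) σ) (Sum.inr ⟨(), f (Sum.inl i)⟩) =
      Quot.mk _ (Sum.inl i) := by
    intro i
    exact (Quot.sound (Glue.mk (H := handle X) () i.1 _ _ (List.finRange_getElem?_val i)
      (List.getElem?_finCast hlen i))).symm
  let q : Quot (Glue (handle X) σ) ≃ (σ ()).V :=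
    { toFun := Quot.lift f hf
      invFun := fun v => Quot.mk _ (Sum.inr ⟨(), v⟩)
      left_inv := by
        rintro ⟨i | x⟩
        · exact hinl i
        · rfl
      right_inv := fun v => rfl }
  refine ⟨q, Equiv.uniqueSigma (α := Unit) fun e => (σ e).E, ?_, ?_, ?_⟩
  · rintro ⟨e, x⟩
    refine Eq.trans ?_ List.map_map.symm
    exact (List.map_id _).symm
  · rintro ⟨e, x⟩
    rfl
  · refine Eq.trans ?_ List.map_map.symm
    refine List.ext_getElem ?_ ?_
    · exact hlen.symm.trans (by rw [List.length_map]; exact List.length_finRange.symm)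
    · intro i h1 h2
      rw [List.getElem_map]
      change _ = (σ ()).ext.get _
      rw [List.get_eq_getElem]
      congr 1
      exact (List.val_finRange_getElem (n := C.type X) (i := i)
        (by rw [List.length_finRange, hlen]; exact h1)).trans rfl

/-- Replacement is associative. -/
theorem replaceAll_replaceAll (H : LabHypergraph C) (σ : H.E → LabHypergraph C)
    (ρ : (Σ e, (σ e).E) → LabHypergraph C) :
    ((H.replaceAll σ).replaceAll ρ).Isomorphic
      (H.replaceAll fun e => (σ e).replaceAll fun x => ρ ⟨e, x⟩) := by
  let σ' : H.E → LabHypergraph C := fun e => (σ e).replaceAll fun x => ρ ⟨e, x⟩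
  let f₀ : (H.V ⊕ Σ e, (σ e).V) → Quot (Glue H σ') := Sum.elim
    (fun v => Quot.mk _ (Sum.inl v))
    fun x => Quot.mk _ (Sum.inr ⟨x.1, Quot.mk _ (Sum.inl x.2)⟩)
  have hf₀ : ∀ a b, Glue H σ a b → f₀ a = f₀ b := by
    rintro _ _ ⟨e, i, v, u, hv, hu⟩
    exact Quot.sound (Glue.mk e i _ _ hv (List.getElem?_map_of _ hu))
  -- Both iterated quotients are generated by the nodes of `H`, of the `σ e` and of the `ρ x`. The
  -- maps `f` and `g` fix these generators, so they are mutually inverse once the gluings are seen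
  -- to be respected.
  let f : ((H.replaceAll σ).V ⊕ Σ x : (H.replaceAll σ).E, (ρ x).V) → Quot (Glue H σ') := Sum.elim
    (Quot.lift f₀ hf₀)
    fun x => Quot.mk _ (Sum.inr ⟨x.1.1, Quot.mk _ (Sum.inr ⟨x.1.2, x.2⟩)⟩)
  have hf : ∀ a b, Glue (H.replaceAll σ) ρ a b → f a = f b := by
    rintro _ _ ⟨⟨e, x⟩, i, v, u, hv, hu⟩
    obtain ⟨z, hz, rfl⟩ := List.exists_of_getElem?_map hv
    change Quot.mk _ _ = Quot.mk _ _
    have : Quot.mk (Glue (σ e) fun x => ρ ⟨e, x⟩) (Sum.inl z) = Quot.mk _ (Sum.inr ⟨x, u⟩) :=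
      Quot.sound (Glue.mk (σ := fun x => ρ ⟨e, x⟩) x i z u hz hu)
    simp only [this]
  let g₀ : ∀ e, ((σ e).V ⊕ Σ x : (σ e).E, (ρ ⟨e, x⟩).V) → Quot (Glue (H.replaceAll σ) ρ) :=
    fun e => Sum.elim (fun u => Quot.mk _ (Sum.inl (Quot.mk _ (Sum.inr ⟨e, u⟩))))
      fun z => Quot.mk _ (Sum.inr ⟨⟨e, z.1⟩, z.2⟩)
  have hg₀ : ∀ e a b, Glue (σ e) (fun x => ρ ⟨e, x⟩) a b → g₀ e a = g₀ e b := by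
    rintro e _ _ ⟨x, i, v, u, hv, hu⟩
    exact Quot.sound (Glue.mk (H := H.replaceAll σ) (σ := ρ) ⟨e, x⟩ i _ _
      (List.getElem?_map_of _ hv) hu)
  let g : (H.V ⊕ Σ e, (σ' e).V) → Quot (Glue (H.replaceAll σ) ρ) := Sum.elim
    (fun v => Quot.mk _ (Sum.inl (Quot.mk _ (Sum.inl v))))
    fun x => Quot.lift (g₀ x.1) (hg₀ x.1) x.2
  have hg : ∀ a b, Glue H σ' a b → g a = g b := by
    rintro _ _ ⟨e, i, v, u, hv, hu⟩
    obtain ⟨z, hz, rfl⟩ := List.exists_of_getElem?_map hu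
    change Quot.mk _ _ = Quot.mk _ _
    have : Quot.mk (Glue H σ) (Sum.inl v) = Quot.mk _ (Sum.inr ⟨e, z⟩) :=
      Quot.sound (Glue.mk e i v z hv hz)
    simp only [this]
  let q : Quot (Glue (H.replaceAll σ) ρ) ≃ Quot (Glue H σ') :=
    { toFun := Quot.lift f hf
      invFun := Quot.lift g hg
      left_inv := by
        rintro ⟨v | ⟨⟨e, x⟩, u⟩⟩
        · obtain ⟨v | ⟨e, u⟩⟩ := v <;> rfl
        · rfl
      right_inv := by
        rintro ⟨v | ⟨e, u⟩⟩
        · rfl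
        · obtain ⟨u | ⟨x, u⟩⟩ := u <;> rfl }
  refine ⟨q, Equiv.sigmaAssoc (fun e x => (ρ ⟨e, x⟩).E), ?_, ?_, ?_⟩
  · rintro ⟨⟨e, x⟩, y⟩
    refine List.map_map.trans (Eq.trans ?_ List.map_map.symm)
    rfl
  · rintro ⟨⟨e, x⟩, y⟩
    rfl
  · change List.map _ H.ext = List.map q (List.map _ (List.map _ H.ext))
    refine Eq.trans ?_ (congrArg (List.map q) List.map_map.symm)
    refine Eq.trans ?_ List.map_map.symm
    rfl

end LabHypergraph

/-! ### Derivations as sequences of tables -/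

namespace LabHypergraph

variable {C : Signature}

/-- `DerivesIn τ H W`: up to isomorphism, `W` is derived from `H` by the tables in `τ`, in this
order. -/
def DerivesIn : List (Set (C.Label × LabHypergraph C)) → LabHypergraph C → LabHypergraph C → Prop
  | [], H, W => H.Isomorphic W
  | T :: τ, H, W => ∃ σ : H.E → LabHypergraph C,
      (∀ e, (H.lab e, σ e) ∈ T) ∧ DerivesIn τ (H.replaceAll σ) W

/-- The hypergraphs derived from the handle of a label by a sequence of tables, obtained by applying
the first table last. -/
def yield : List (Set (C.Label × LabHypergraph C)) → C.Label → Set (LabHypergraph C)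
  | [], X => {H | H.Isomorphic (handle X)}
  | T :: τ, X => {H | ∃ (R : LabHypergraph C) (ρ : R.E → LabHypergraph C),
      (X, R) ∈ T ∧ (∀ e, ρ e ∈ yield τ (R.lab e)) ∧ H.Isomorphic (R.replaceAll ρ)}

theorem DerivesIn.congr_left {τ : List (Set (C.Label × LabHypergraph C))}
    {H H' W : LabHypergraph C} (h : H.Isomorphic H') (hW : DerivesIn τ H W) :
    DerivesIn τ H' W := by
  induction τ generalizing H H' with
  | nil => exact h.symm.trans hW
  | cons T τ ih =>
    obtain ⟨gV, gE, h1, h2, h3⟩ := h.symm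
    obtain ⟨σ, hσ, hW⟩ := hW
    refine ⟨fun e => σ (gE e), fun e => h2 e ▸ hσ (gE e), ih ?_ hW⟩
    exact (replaceAll_congr gV gE h1 h3 fun e => Isomorphic.refl _).symm

theorem yield_congr {τ : List (Set (C.Label × LabHypergraph C))} {X : C.Label}
    {H H' : LabHypergraph C} (h : H.Isomorphic H') (hH : H ∈ yield τ X) : H' ∈ yield τ X := by
  cases τ with
  | nil => exact h.symm.trans hH
  | cons T τ =>
    obtain ⟨R, ρ, h1, h2, h3⟩ := hH
    exact ⟨R, ρ, h1, h2, h.symm.trans h3⟩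

theorem Isomorphic.type_eq {H H' : LabHypergraph C} (h : H.Isomorphic H') : H.type = H'.type := by
  obtain ⟨gV, gE, h1, h2, h3⟩ := h
  simp [type, h3]

theorem type_of_mem_yield {τ : List (Set (C.Label × LabHypergraph C))}
    (hτ : ∀ T ∈ τ, IsTable T) {X : C.Label} {H : LabHypergraph C} (hH : H ∈ yield τ X) :
    H.type = C.type X := by
  cases τ with
  | nil => exact hH.type_eq.trans List.length_finRange
  | cons T τ =>
    obtain ⟨R, ρ, h1, h2, h3⟩ := hH
    refine h3.type_eq.trans (Eq.trans ?_ ((hτ T (by simp)).type_eq _ h1))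
    simp [type, replaceAll]

/-- The hyperedges of a hypergraph derive independently of each other. -/
theorem derivesIn_iff {τ : List (Set (C.Label × LabHypergraph C))} {H W : LabHypergraph C} :
    DerivesIn τ H W ↔ ∃ ρ : H.E → LabHypergraph C,
      (∀ e, ρ e ∈ yield τ (H.lab e)) ∧ W.Isomorphic (H.replaceAll ρ) := by
  induction τ generalizing H with
  | nil =>
    constructor
    · intro h
      exact ⟨fun e => handle (H.lab e), fun e => Isomorphic.refl _,
        (h : H.Isomorphic W).symm.trans (replaceAll_handle H).symm⟩
    · rintro ⟨ρ, h1, h2⟩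
      exact ((h2.trans (replaceAll_congr_right h1)).trans (replaceAll_handle H)).symm
  | cons T τ ih =>
    constructor
    · rintro ⟨σ, hσ, hW⟩
      obtain ⟨ρ, h1, h2⟩ := ih.1 hW
      exact ⟨fun e => (σ e).replaceAll fun x => ρ ⟨e, x⟩,
        fun e => ⟨σ e, fun x => ρ ⟨e, x⟩, hσ e, fun x => h1 ⟨e, x⟩, Isomorphic.refl _⟩,
        h2.trans (replaceAll_replaceAll H σ ρ)⟩
    · rintro ⟨ρ, h1, h2⟩
      -- All hyperedges follow the same sequence `T :: τ`, so their first rules all come from `T`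
      -- and together form one parallel step.
      choose σ π h3 h4 h5 using h1
      refine ⟨σ, h3, ih.2 ⟨fun x => π x.1 x.2, fun x => h4 x.1 x.2, ?_⟩⟩
      exact h2.trans ((replaceAll_congr_right h5).trans
        (replaceAll_replaceAll H σ fun x => π x.1 x.2).symm)

/-- A handle has a single hyperedge, and replacing it by a hypergraph of the right type gives back
that hypergraph. The tables guarantee the type. -/
theorem derivesIn_handle_iff {τ : List (Set (C.Label × LabHypergraph C))}
    (hτ : ∀ T ∈ τ, IsTable T) {X : C.Label} {W : LabHypergraph C} :
    DerivesIn τ (handle X) W ↔ W ∈ yield τ X := by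
  rw [derivesIn_iff]
  constructor
  · rintro ⟨ρ, h1, h2⟩
    have h3 : ρ () ∈ yield τ X := h1 ()
    exact yield_congr (h2.trans (handle_replaceAll X ρ (type_of_mem_yield hτ h3))).symm h3
  · intro h
    exact ⟨fun _ => W, fun _ => h,
      (handle_replaceAll X (fun _ => W) (type_of_mem_yield hτ h)).symm⟩

theorem DirectlyDerives.derivesIn {T : Set (C.Label × LabHypergraph C)}
    {τ : List (Set (C.Label × LabHypergraph C))} {H H' W : LabHypergraph C}
    (h : DirectlyDerives T H H') (hW : DerivesIn τ H' W) : DerivesIn (T :: τ) H W := by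
  obtain ⟨σ, hσ, h⟩ := h
  exact ⟨σ, hσ, hW.congr_left h⟩

/-- A direct derivation allows an isomorphism at every step, `DerivesIn` only at the end. This loses
nothing because `DerivesIn` is invariant under isomorphism of its source. -/
theorem derives_iff {G : PHRGrammar C} {H W : LabHypergraph C} :
    G.Derives H W ↔ ∃ τ, (∀ T ∈ τ, T ∈ G.tables) ∧ DerivesIn τ H W := by
  constructor
  · rintro (h | h)
    · exact ⟨[], by simp, h⟩
    · induction h using Relation.TransGen.head_induction_on with
      | single h =>
        obtain ⟨T, hT, h⟩ := h
        exact ⟨[T], by simpa using hT,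
          DirectlyDerives.derivesIn h (Isomorphic.refl W : DerivesIn [] W W)⟩
      | head h _ ih =>
        obtain ⟨T, hT, h⟩ := h
        obtain ⟨τ, hτ, hW⟩ := ih
        exact ⟨T :: τ, by simpa using ⟨hT, hτ⟩, DirectlyDerives.derivesIn h hW⟩
  · rintro ⟨τ, hτ, hW⟩
    induction τ generalizing H with
    | nil => exact Or.inl hW
    | cons T τ ih =>
      obtain ⟨σ, hσ, hW⟩ := hW
      have hT : T ∈ G.tables := hτ T (by simp)
      refine Or.inr ?_
      rcases ih (fun T' h' => hτ T' (by simp [h'])) hW with h | h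
      · exact Relation.TransGen.single ⟨T, hT, σ, hσ, h.symm⟩
      · exact Relation.TransGen.head ⟨T, hT, σ, hσ, Isomorphic.refl _⟩ h

/-! ### Small hypergraphs and their finite codes -/

/-- A hypergraph with at most `b` nodes that are not external and at most `b` hyperedges. -/
def Small (b : ℕ) (H : LabHypergraph C) : Prop :=
  Nat.card {v : H.V // v ∉ H.ext} ≤ b ∧ Nat.card H.E ≤ b

theorem Small.congr {b : ℕ} {H H' : LabHypergraph C} (h : H.Isomorphic H') (hH : H.Small b) :
    H'.Small b := by
  obtain ⟨gV, gE, h1, h2, h3⟩ := h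
  have e : {v : H.V // v ∉ H.ext} ≃ {v : H'.V // v ∉ H'.ext} :=
    gV.subtypeEquiv fun v => by simp [h3]
  exact ⟨(Nat.card_congr e).symm.trans_le hH.1, (Nat.card_congr gE).symm.trans_le hH.2⟩

/-- Nodes of a replacement that are not external survive unmerged. -/
theorem mk_inr_eq_iff {H : LabHypergraph C} {σ : H.E → LabHypergraph C} {e : H.E} {u : (σ e).V}
    (hu : u ∉ (σ e).ext) (x : H.V ⊕ Σ e, (σ e).V) :
    Quot.mk (Glue H σ) x = Quot.mk _ (Sum.inr ⟨e, u⟩) ↔ x = Sum.inr ⟨e, u⟩ := by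
  refine ⟨fun h => ?_, fun h => by rw [h]⟩
  -- Being this very node is invariant under `Glue`, since on the right-hand side `Glue` only
  -- touches external nodes.
  let p : Quot (Glue H σ) → Prop := Quot.lift (fun y => y = Sum.inr ⟨e, u⟩) (by
    rintro _ _ ⟨e', i, v, u', hv, hu'⟩
    simp only [reduceCtorEq, Sum.inr.injEq, eq_iff_iff, false_iff]
    intro heq
    cases heq
    exact hu (List.mem_of_getElem? hu'))
  have : p (Quot.mk _ x) = p (Quot.mk _ (Sum.inr ⟨e, u⟩)) := congrArg p h
  exact this.mpr rfl

/-- What replaces a hyperedge in a small hypergraph is small. -/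
theorem Small.of_replaceAll {b : ℕ} {H : LabHypergraph C} {σ : H.E → LabHypergraph C}
    (h : (H.replaceAll σ).Small b) (e : H.E) : (σ e).Small b := by
  have := (H.replaceAll σ).finite_V
  have := (H.replaceAll σ).finite_E
  constructor
  -- External nodes of `σ e` may be merged with each other in the result, so only the remaining ones
  -- can be counted there. These stay distinct and do not become external.
  · refine le_trans (Nat.card_le_card_of_injective (β := {v // v ∉ (H.replaceAll σ).ext})
      (fun u => ⟨Quot.mk _ (Sum.inr ⟨e, u.1⟩), ?_⟩) ?_) h.1
    · intro hmem
      obtain ⟨v, hv, heq⟩ := List.mem_map.1 hmem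
      simpa using (mk_inr_eq_iff u.2 _).1 heq
    · intro u u' huu
      have := (mk_inr_eq_iff u'.2 _).1 (congrArg Subtype.val huu)
      simp only [Sum.inr.injEq, Sigma.mk.injEq, heq_eq_eq, true_and] at this
      exact Subtype.ext this
  · refine le_trans (Nat.card_le_card_of_injective (β := (H.replaceAll σ).E)
      (fun x => ⟨e, x⟩) ?_) h.2
    intro x x' hxx
    exact eq_of_heq (Sigma.mk.inj hxx).2

/-- The external nodes number at most the length of `ext`; repetitions only lower the count. -/
theorem Small.card_V_le {b K : ℕ} {H : LabHypergraph C} (h : H.Small b) (hK : H.type ≤ K) :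
    Nat.card H.V ≤ b + K := by
  classical
  have := H.finite_V
  have h1 : Nat.card {v : H.V // v ∈ H.ext} ≤ K := by
    exact (Nat.subtype_card H.ext.toFinset (by simp)).trans_le
      ((List.toFinset_card_le H.ext).trans hK)
  have h2 := Nat.card_congr (Equiv.sumCompl fun v : H.V => v ∈ H.ext)
  rw [Nat.card_sum] at h2
  have := h.1
  omega

/-- Finite data that determine a hypergraph with at most `M` nodes, at most `N` hyperedges and types
at most `K`. -/
abbrev BoundedCode (C : Signature) (M N K : ℕ) : Type :=
  (Fin M → Bool) × (Fin N → Option (C.Label × (Fin K → Option (Fin M)))) ×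
    (Fin K → Option (Fin M))

/-- `c` determines `H` through numberings of its nodes and hyperedges. -/
def HasCode {M N K : ℕ} (H : LabHypergraph C) (c : BoundedCode C M N K) : Prop :=
  ∃ (v : H.V ↪ Fin M) (e : H.E ↪ Fin N),
    (∀ i, c.1 i = true ↔ ∃ u, v u = i) ∧
    (∀ j z, c.2.1 j = some z ↔
      ∃ y, e y = j ∧ (H.lab y, fun i : Fin K => ((H.att y).map v)[i.1]?) = z) ∧
    (fun i : Fin K => (H.ext.map v)[i.1]?) = c.2.2

theorem exists_hasCode {M N K : ℕ} (H : LabHypergraph C) (hM : Nat.card H.V ≤ M)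
    (hN : Nat.card H.E ≤ N) : ∃ c : BoundedCode C M N K, H.HasCode c := by
  classical
  have := H.finite_V
  have := H.finite_E
  have := Fintype.ofFinite H.V
  have := Fintype.ofFinite H.E
  obtain ⟨v⟩ := Function.Embedding.nonempty_of_card_le (α := H.V) (β := Fin M)
    (by simpa [Nat.card_eq_fintype_card] using hM)
  obtain ⟨e⟩ := Function.Embedding.nonempty_of_card_le (α := H.E) (β := Fin N)
    (by simpa [Nat.card_eq_fintype_card] using hN)
  refine ⟨(fun i => decide (∃ u, v u = i), fun j => (Function.partialInv e j).map fun y =>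
    (H.lab y, fun i : Fin K => ((H.att y).map v)[i.1]?), fun i => (H.ext.map v)[i.1]?),
    v, e, ?_, ?_, rfl⟩
  · simp
  · intro j z
    simp only [Option.map_eq_some_iff, e.injective.isPartialInv _ _]

/-- Both lists have ended by position `K`, so the first `K` optional entries determine them, and
`v'` can be cancelled. -/
theorem map_eq_of_getElem?_eq {α β γ : Type*} {K : ℕ} {l : List α} {l' : List β} {v : α → γ}
    {v' : β → γ} {g : α → β} (hv' : Function.Injective v') (hg : ∀ a, v' (g a) = v a)
    (hl : l.length ≤ K) (hl' : l'.length ≤ K)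
    (h : (fun i : Fin K => (l.map v)[i.1]?) = fun i : Fin K => (l'.map v')[i.1]?) :
    l' = l.map g := by
  refine List.map_injective_iff.2 hv' ?_
  rw [List.map_map, funext hg (f := v' ∘ g)]
  refine List.ext_getElem? fun i => ?_
  by_cases hi : i < K
  · exact (congrFun h ⟨i, hi⟩).symm
  · rw [List.getElem?_eq_none (by simp; omega), List.getElem?_eq_none (by simp; omega)]

theorem exists_equiv_of_range_eq {α β γ : Type*} (v : α ↪ γ) (v' : β ↪ γ)
    (h : Set.range v = Set.range v') : ∃ g : α ≃ β, ∀ a, v' (g a) = v a := by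
  refine ⟨(Equiv.ofInjective v v.injective).trans ((Equiv.setCongr h).trans
    (Equiv.ofInjective v' v'.injective).symm), fun a => ?_⟩
  simp [Equiv.apply_ofInjective_symm]

/-- The code records the ranges of both numberings, so composing one numbering with the inverse of
the other gives bijections on nodes and hyperedges. The bounds by `K` ensure that no attachment or
external sequence was truncated. -/
theorem HasCode.isomorphic {M N K : ℕ} {H H' : LabHypergraph C} {c : BoundedCode C M N K}
    (h : H.HasCode c) (h' : H'.HasCode c) (hC : ∀ X : C.Label, C.type X ≤ K)
    (hH : H.type ≤ K) (hH' : H'.type ≤ K) : H.Isomorphic H' := by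
  obtain ⟨v, e, h1, h2, h3⟩ := h
  obtain ⟨v', e', h1', h2', h3'⟩ := h'
  obtain ⟨gV, hV⟩ := exists_equiv_of_range_eq v v' (by
    ext i
    exact (h1 i).symm.trans (h1' i))
  obtain ⟨gE, hE⟩ := exists_equiv_of_range_eq e e' (by
    ext j
    constructor
    · rintro ⟨y, rfl⟩
      obtain ⟨y', hy', -⟩ := (h2' _ _).1 ((h2 _ _).2 ⟨y, rfl, rfl⟩)
      exact ⟨y', hy'⟩
    · rintro ⟨y, rfl⟩
      obtain ⟨y', hy', -⟩ := (h2 _ _).1 ((h2' _ _).2 ⟨y, rfl, rfl⟩)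
      exact ⟨y', hy'⟩)
  have hlab : ∀ y, H'.lab (gE y) = H.lab y ∧ H'.att (gE y) = (H.att y).map gV := by
    intro y
    obtain ⟨y', hy', heq⟩ := (h2' _ _).1 ((h2 _ _).2 ⟨y, rfl, rfl⟩)
    rw [← hE] at hy'
    obtain rfl := e'.injective hy'
    obtain ⟨hl, ha⟩ := Prod.mk.inj heq
    refine ⟨hl, map_eq_of_getElem?_eq v'.injective hV ?_ ?_ ha.symm⟩
    · exact (H.length_att _).trans_le (hC _)
    · exact (H'.length_att _).trans_le (hC _)
  exact ⟨gV, gE, fun y => (hlab y).2, fun y => (hlab y).1,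
    map_eq_of_getElem?_eq v'.injective hV hH hH' (h3.trans h3'.symm)⟩

/-- The codes of the small hypergraphs that the labels yield. -/
def smallYield (b K : ℕ) (τ : List (Set (C.Label × LabHypergraph C))) (X : C.Label) :
    Set (BoundedCode C (b + K) b K) :=
  {c | ∃ H ∈ yield τ X, H.Small b ∧ H.HasCode c}

/-- A code determines its hypergraph up to isomorphism and yields are closed under isomorphism, so
comparing codes compares the small hypergraphs themselves. -/
theorem mem_yield_of_smallYield_eq {b K : ℕ} (hC : ∀ X : C.Label, C.type X ≤ K)
    {τ τ' : List (Set (C.Label × LabHypergraph C))} (hτ : ∀ T ∈ τ, IsTable T)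
    (hτ' : ∀ T ∈ τ', IsTable T) {X : C.Label}
    (h : smallYield b K τ X = smallYield b K τ' X) {H : LabHypergraph C} (hb : H.Small b)
    (hH : H ∈ yield τ X) : H ∈ yield τ' X := by
  have hK := (type_of_mem_yield hτ hH).trans_le (hC X)
  obtain ⟨c, hc⟩ := exists_hasCode (K := K) H (hb.card_V_le hK) hb.2
  have hmem : c ∈ smallYield b K τ X := ⟨H, hH, hb, hc⟩
  rw [h] at hmem
  obtain ⟨H', hH', -, hc'⟩ := hmem
  exact yield_congr (hc'.isomorphic hc hC ((type_of_mem_yield hτ' hH').trans_le (hC X)) hK) hH'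

/-- The heart of the bound: if `R.replaceAll ρ` is small, then so is each `ρ e`. Only the small part
of what `τ` yields is therefore used, and the same fillings are available under `τ'`. -/
theorem smallYield_cons_eq {b K : ℕ} (hC : ∀ X : C.Label, C.type X ≤ K)
    {τ τ' : List (Set (C.Label × LabHypergraph C))} (hτ : ∀ T ∈ τ, IsTable T)
    (hτ' : ∀ T ∈ τ', IsTable T) (h : smallYield b K τ = smallYield b K τ')
    (T : Set (C.Label × LabHypergraph C)) :
    smallYield b K (T :: τ) = smallYield b K (T :: τ') := by
  have key : ∀ {τ τ' : List (Set (C.Label × LabHypergraph C))}, (∀ T ∈ τ, IsTable T) →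
      (∀ T ∈ τ', IsTable T) → smallYield b K τ = smallYield b K τ' → ∀ X,
      smallYield b K (T :: τ) X ⊆ smallYield b K (T :: τ') X := by
    rintro τ τ' hτ hτ' h X c ⟨H, ⟨R, ρ, h1, h2, h3⟩, hb, hc⟩
    refine ⟨H, ⟨R, ρ, h1, fun e => ?_, h3⟩, hb, hc⟩
    exact mem_yield_of_smallYield_eq hC hτ hτ' (congrFun h _) ((hb.congr h3).of_replaceAll e) (h2 e)
  funext X
  exact Set.Subset.antisymm (key hτ hτ' h X) (key hτ' hτ h.symm X)

end LabHypergraph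

/-! ### Pigeonhole and short derivations -/

/-- If `key (a :: l)` only depends on `a` and `key l`, and `key` has a finite range, then every
value of `key` is attained on a short list. -/
theorem exists_short_list {α S : Type*} [Finite S] (p : α → Prop) (key : List α → S)
    (hkey : ∀ a l l', (∀ x ∈ l, p x) → (∀ x ∈ l', p x) → key l = key l' →
      key (a :: l) = key (a :: l'))
    (l : List α) (hl : ∀ x ∈ l, p x) :
    ∃ l' : List α, (∀ x ∈ l', p x) ∧ l'.length ≤ Nat.card S ∧ key l' = key l := by
  have happ : ∀ k l l' : List α, (∀ x ∈ k, p x) → (∀ x ∈ l, p x) → (∀ x ∈ l', p x) →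
      key l = key l' → key (k ++ l) = key (k ++ l') := by
    intro k l l' hk hl hl' h
    induction k with
    | nil => exact h
    | cons a k ih =>
      have hk' : ∀ x ∈ k, p x := fun x hx => hk x (by simp [hx])
      refine hkey _ _ _ ?_ ?_ (ih hk') <;>
      · intro x hx
        rcases List.mem_append.1 hx with hx | hx
        · exact hk' x hx
        · first | exact hl x hx | exact hl' x hx
  induction hn : l.length using Nat.strong_induction_on generalizing l with
  | _ n ih =>
    by_cases hle : l.length ≤ Nat.card S
    · exact ⟨l, hl, hle, rfl⟩
    -- Pigeonhole on the suffixes of `l`, the empty one included: there are more of them than values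
    -- of `key`.
    · have : ¬ Function.Injective fun i : Fin (l.length + 1) => key (l.drop i) := by
        intro hinj
        have := Nat.card_le_card_of_injective _ hinj
        simp at this
        omega
      simp only [Function.Injective, not_forall] at this
      obtain ⟨i, j, hij, hne⟩ := this
      wlog hlt : i < j generalizing i j
      · exact this j i hij.symm (Ne.symm hne) (lt_of_le_of_ne (not_lt.1 hlt) (Ne.symm hne))
      have hdrop : ∀ (m : ℕ) (x : α), x ∈ l.drop m → p x :=
        fun m x hx => hl x (List.mem_of_mem_drop hx)
      have htake : ∀ x ∈ l.take i, p x := fun x hx => hl x (List.mem_of_mem_take hx)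
      -- The segment between the two suffixes with equal keys is removed; by `happ` this does not
      -- change the key of the whole list.
      have hlen : (l.take i ++ l.drop j).length < n := by
        simp only [List.length_append, List.length_take, List.length_drop]
        have := j.2
        have : i.1 < j.1 := hlt
        omega
      obtain ⟨l', h1, h2, h3⟩ := ih _ hlen (l.take i ++ l.drop j)
        (fun x hx => (List.mem_append.1 hx).elim (htake x) (hdrop j x)) rfl
      refine ⟨l', h1, h2, h3.trans ?_⟩
      rw [← happ _ _ _ htake (hdrop i) (hdrop j) hij, List.take_append_drop]

/-- A bound on the number of families of sets of small hypergraphs, for `q` labels of type at most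
`K`. -/
def derivationBound (q K b : ℕ) : ℕ :=
  (2 ^ (2 ^ (b + K) * ((q * (b + K + 1) ^ K + 1) ^ b * (b + K + 1) ^ K))) ^ q

namespace LabHypergraph

variable {C : Signature}

/-- Small hypergraphs have short derivations. -/
theorem exists_short_derivation {b K : ℕ} (hC : ∀ X : C.Label, C.type X ≤ K)
    {τ : List (Set (C.Label × LabHypergraph C))} (hτ : ∀ T ∈ τ, IsTable T)
    {p : Set (C.Label × LabHypergraph C) → Prop} (hp : ∀ T ∈ τ, p T) {X : C.Label}
    {H : LabHypergraph C} (hb : H.Small b) (hH : DerivesIn τ (handle X) H) :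
    ∃ τ', (∀ T ∈ τ', p T) ∧ τ'.length ≤ derivationBound (Nat.card C.Label) K b ∧
      DerivesIn τ' (handle X) H := by
  classical
  have := C.finite_label
  have := Fintype.ofFinite C.Label
  obtain ⟨τ', h1, h2, h3⟩ := exists_short_list (fun T => IsTable T ∧ p T)
    (smallYield (C := C) b K)
    (fun T l l' hl hl' h => smallYield_cons_eq hC (fun T hT => (hl T hT).1)
      (fun T hT => (hl' T hT).1) h T) τ fun T hT => ⟨hτ T hT, hp T hT⟩
  have hτ' : ∀ T ∈ τ', IsTable T := fun T hT => (h1 T hT).1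
  refine ⟨τ', fun T hT => (h1 T hT).2, h2.trans (le_of_eq ?_), ?_⟩
  -- `derivationBound` is exactly the number of functions from labels to sets of codes.
  · simp [Nat.card_eq_fintype_card, derivationBound, BoundedCode]
  · rw [derivesIn_handle_iff hτ] at hH
    rw [derivesIn_handle_iff hτ']
    exact mem_yield_of_smallYield_eq hC hτ hτ' (congrFun h3.symm X) hb hH

end LabHypergraph

/-! ### Presentations: hypergraphs with unresolved node identifications -/

/-- Finite data for a hypergraph whose nodes are given up to an equivalence relation: the list of
names, the pairs of names that are identified, the hyperedges and the external nodes. -/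
abbrev NetCode := List ℕ × List (ℕ × ℕ) × List (ℕ × List ℕ) × List ℕ

/-- A hypergraph `H` is described by `d`: the names in `d` stand for nodes of `H`, and two names
stand for the same node exactly if the listed pairs identify them. -/
structure Presentation {C : Signature} {n : ℕ} (ν : C.Label ≃ Fin n) (d : NetCode)
    (H : LabHypergraph C) where
  P : Type
  name : P → ℕ
  proj : P → H.V
  rel : P → P → Prop
  edges : List H.E
  att : H.E → List P
  ext : List P
  name_injective : Function.Injective name
  mem_nodes : ∀ k, k ∈ d.1 ↔ ∃ p, name p = k
  proj_surjective : Function.Surjective proj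
  mem_eqs : ∀ q, q ∈ d.2.1 ↔ ∃ p p', rel p p' ∧ (name p, name p') = q
  proj_eq : ∀ p p', rel p p' → proj p = proj p'
  mk_eq : ∀ p p', proj p = proj p' → Quot.mk rel p = Quot.mk rel p'
  edges_nodup : edges.Nodup
  mem_edges : ∀ e, e ∈ edges
  edges_eq : d.2.2.1 = edges.map fun e => ((ν (H.lab e) : ℕ), (att e).map name)
  att_eq : ∀ e, H.att e = (att e).map proj
  ext_name : d.2.2.2 = ext.map name
  ext_eq : H.ext = ext.map proj

/-- The data for the result of replacing all hyperedges of `d`, given for every hyperedge its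
attachment nodes and its replacement. -/
def NetCode.expand (d : NetCode) (ch : List (List ℕ × HypergraphCode)) : NetCode :=
  (d.1.map (Nat.pair 0) ++
      ch.zipIdx.flatMap fun p => (List.range p.1.2.1).map (Nat.pair (p.2 + 1)),
    (d.2.1.map fun q => (Nat.pair 0 q.1, Nat.pair 0 q.2)) ++
      ch.zipIdx.flatMap fun p =>
        (p.1.1.map (Nat.pair 0)).zip (p.1.2.2.2.map (Nat.pair (p.2 + 1))),
    ch.zipIdx.flatMap fun p => p.1.2.2.1.map fun q => (q.1, q.2.map (Nat.pair (p.2 + 1))),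
    d.2.2.2.map (Nat.pair 0))

/-- All ways to choose a rule of `tab` for every hyperedge in a list. -/
def ruleChoices (tab : List RuleCode) (es : List (ℕ × List ℕ)) :
    List (List (List ℕ × HypergraphCode)) :=
  (es.map fun q => (tab.filter fun r => r.1 = q.1).map fun r => (q.2, r.2)).sections

/-- All results of one parallel derivation step. -/
def NetCode.step (tabs : List (List RuleCode)) (d : NetCode) : List NetCode :=
  tabs.flatMap fun tab => (ruleChoices tab d.2.2.1).map d.expand

/-- All results of `t` parallel derivation steps. -/
def NetCode.steps (tabs : List (List RuleCode)) (d : NetCode) (t : ℕ) : List NetCode :=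
  Nat.rec [d] (fun _ ds => ds.flatMap (NetCode.step tabs)) t

/-- The data for a handle. -/
def NetCode.handle (X k : ℕ) : NetCode :=
  (List.range k, [], [(X, List.range k)], List.range k)

/-- Replacements are told apart by the position of their hyperedge in the list; without repetitions
this position is a function of the hyperedge. -/
theorem List.Nodup.zipIdx_map_eq {α β : Type*} [DecidableEq α] {l : List α} (hl : l.Nodup)
    (g : α → β) : (l.map g).zipIdx = l.map fun a => (g a, l.idxOf a) := by
  refine List.ext_getElem (by simp) fun i h1 h2 => ?_
  have hi : i < l.length := by simpa using h2
  simp [hl.idxOf_getElem i hi]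

theorem List.mem_zip_iff {α β : Type*} {l : List α} {l' : List β} {q : α × β} :
    q ∈ l.zip l' ↔ ∃ i : ℕ, l[i]? = some q.1 ∧ l'[i]? = some q.2 := by
  simp only [List.mem_iff_getElem?, List.getElem?_zip_eq_some]

/-- A list that is related to a nodup list entry by entry is obtained by applying a function. -/
theorem List.Forall₂.exists_eq_map {α β : Type*} [Nonempty β] {R : β → α → Prop} {l : List α}
    {l' : List β} (h : List.Forall₂ R l' l) (hl : l.Nodup) :
    ∃ g : α → β, l' = l.map g ∧ ∀ a ∈ l, R (g a) a := by
  classical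
  induction h with
  | nil => exact ⟨fun _ => Classical.arbitrary β, rfl, by simp⟩
  | @cons b a l' l hR _ ih =>
    obtain ⟨ha, hl⟩ := List.nodup_cons.1 hl
    obtain ⟨g, rfl, hg⟩ := ih hl
    refine ⟨Function.update g a b, ?_, ?_⟩
    · rw [List.map_cons, Function.update_self]
      congr 1
      refine List.map_congr_left fun x hx => ?_
      rw [Function.update_of_ne (by rintro rfl; exact ha hx)]
    · intro x hx
      rcases List.mem_cons.1 hx with rfl | hxl
      · rwa [Function.update_self]
      · rw [Function.update_of_ne (by rintro rfl; exact ha hxl)]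
        exact hg x hxl

namespace Presentation

variable {C : Signature} {n : ℕ} {ν : C.Label ≃ Fin n} {d : NetCode} {H : LabHypergraph C}

/-- The handle is described by its data. -/
def ofHandle (ν : C.Label ≃ Fin n) (X : C.Label) :
    Presentation ν (NetCode.handle (ν X) (C.type X)) (LabHypergraph.handle X) where
  P := Fin (C.type X)
  name := fun i => i
  proj := fun i => i
  rel := fun _ _ => False
  edges := [()]
  att := fun _ => List.finRange (C.type X)
  ext := List.finRange (C.type X)
  name_injective := Fin.val_injective
  mem_nodes := fun k => by
    simp only [NetCode.handle, List.mem_range]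
    exact ⟨fun h => ⟨⟨k, h⟩, rfl⟩, by rintro ⟨i, rfl⟩; exact i.2⟩
  proj_surjective := fun i => ⟨i, rfl⟩
  mem_eqs := by simp [NetCode.handle]
  proj_eq := by simp
  mk_eq := fun p p' h => congrArg _ h
  edges_nodup := List.nodup_singleton _
  mem_edges := fun _ => List.mem_singleton.2 rfl
  edges_eq := by simp [NetCode.handle, LabHypergraph.handle]
  att_eq := fun _ => (List.map_id _).symm
  ext_name := by simp [NetCode.handle]
  ext_eq := (List.map_id _).symm

open Classical in
/-- Replacing hyperedges is described by `NetCode.expand`. -/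
theorem nonempty_expand (D : Presentation ν d H) (σ : H.E → LabHypergraph C)
    (r : H.E → HypergraphCode) (hr : ∀ e, (r e).Describes ν (σ e)) :
    Nonempty (Presentation ν (d.expand (D.edges.map fun e => ((D.att e).map D.name, r e)))
      (H.replaceAll σ)) := by
  choose v y hy hx using hr
  have hz := D.edges_nodup.zipIdx_map_eq fun e => ((D.att e).map D.name, r e)
  have hidx : Function.Injective (D.edges.idxOf ·) := fun a b hab =>
    (List.idxOf_inj (D.mem_edges a)).1 hab
  refine ⟨{
    P := D.P ⊕ Σ e, (σ e).V
    -- Tag `0` marks the old names; tag `i + 1` marks the nodes of what replaces the hyperedge at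
    -- position `i`. This keeps all names distinct.
    name := Sum.elim (fun p => Nat.pair 0 (D.name p))
      fun x => Nat.pair (D.edges.idxOf x.1 + 1) (v x.1 x.2)
    proj := Sum.elim (fun p => Quot.mk _ (Sum.inl (D.proj p))) fun x => Quot.mk _ (Sum.inr x)
    rel := fun a b => (∃ p p', D.rel p p' ∧ a = Sum.inl p ∧ b = Sum.inl p') ∨
      ∃ (e : H.E) (i : ℕ) (p : D.P) (u : (σ e).V), (D.att e)[i]? = some p ∧ (σ e).ext[i]? = some u ∧ a = Sum.inl p ∧
        b = Sum.inr ⟨e, u⟩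
    edges := D.edges.flatMap fun e => (List.ofFn (y e).symm).map (Sigma.mk e)
    att := fun x => ((σ x.1).att x.2).map fun u => Sum.inr ⟨x.1, u⟩
    ext := D.ext.map Sum.inl
    name_injective := ?_
    mem_nodes := ?_
    proj_surjective := ?_
    mem_eqs := ?_
    proj_eq := ?_
    mk_eq := ?_
    edges_nodup := ?_
    mem_edges := ?_
    edges_eq := ?_
    att_eq := ?_
    ext_name := ?_
    ext_eq := ?_ }⟩
  · rintro (p | ⟨e, u⟩) (p' | ⟨e', u'⟩) h
    · simp only [Sum.elim_inl, Nat.pair_eq_pair, true_and] at h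
      rw [D.name_injective h]
    · simp [Nat.pair_eq_pair] at h
    · simp [Nat.pair_eq_pair] at h
    · simp only [Sum.elim_inr, Nat.pair_eq_pair, Nat.add_right_cancel_iff] at h
      obtain rfl := hidx h.1
      rw [(v e).injective (Fin.val_injective h.2)]
  · intro k
    simp only [NetCode.expand, hz, List.mem_append, List.mem_map, List.mem_flatMap,
      List.mem_range, Sum.exists, Sum.elim_inl, Sum.elim_inr]
    refine or_congr ?_ ?_
    · constructor
      · rintro ⟨a, ha, rfl⟩
        obtain ⟨p, rfl⟩ := (D.mem_nodes a).1 ha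
        exact ⟨p, rfl⟩
      · rintro ⟨p, rfl⟩
        exact ⟨_, (D.mem_nodes _).2 ⟨p, rfl⟩, rfl⟩
    · constructor
      · rintro ⟨_, ⟨e, he, rfl⟩, i, hi, rfl⟩
        refine ⟨⟨e, (v e).symm ⟨i, hi⟩⟩, ?_⟩
        simp
      · rintro ⟨⟨e, u⟩, rfl⟩
        exact ⟨_, ⟨e, D.mem_edges e, rfl⟩, v e u, (v e u).2, rfl⟩
  · rintro ⟨a | x⟩
    · obtain ⟨p, rfl⟩ := D.proj_surjective a
      exact ⟨Sum.inl p, rfl⟩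
    · exact ⟨Sum.inr x, rfl⟩
  · rintro ⟨a, b⟩
    simp only [NetCode.expand, hz, List.mem_append, List.mem_map, List.mem_flatMap]
    constructor
    · rintro (⟨q, hq, hab⟩ | ⟨_, ⟨e, he, rfl⟩, hq⟩)
      · obtain ⟨p, p', hp, rfl⟩ := (D.mem_eqs q).1 hq
        exact ⟨Sum.inl p, Sum.inl p', Or.inl ⟨p, p', hp, rfl, rfl⟩, hab⟩
      · obtain ⟨i, h1, h2⟩ := List.mem_zip_iff.1 hq
        simp only [hx, List.map_map] at h1 h2
        obtain ⟨p, hp, h1⟩ := List.exists_of_getElem?_map h1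
        obtain ⟨u, hu, h2⟩ := List.exists_of_getElem?_map h2
        exact ⟨Sum.inl p, Sum.inr ⟨e, u⟩, Or.inr ⟨e, i, p, u, hp, hu, rfl, rfl⟩,
          Prod.ext h1 h2⟩
    · rintro ⟨_, _, ⟨p, p', hp, rfl, rfl⟩ | ⟨e, i, p, u, hp, hu, rfl, rfl⟩, hab⟩
      · exact Or.inl ⟨_, (D.mem_eqs _).2 ⟨p, p', hp, rfl⟩, hab⟩
      · refine Or.inr ⟨_, ⟨e, D.mem_edges e, rfl⟩, List.mem_zip_iff.2 ⟨i, ?_, ?_⟩⟩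
        · rw [← hab, List.map_map]
          exact List.getElem?_map_of _ hp
        · rw [← hab, hx, List.map_map]
          exact List.getElem?_map_of _ hu
  · rintro _ _ (⟨p, p', hp, rfl, rfl⟩ | ⟨e, i, p, u, hp, hu, rfl, rfl⟩)
    · exact congrArg (fun a => Quot.mk (H.Glue σ) (Sum.inl a)) (D.proj_eq p p' hp)
    · refine Quot.sound (LabHypergraph.Glue.mk e i _ _ ?_ hu)
      rw [D.att_eq]
      exact List.getElem?_map_of _ hp
  · let R : (D.P ⊕ Σ e, (σ e).V) → (D.P ⊕ Σ e, (σ e).V) → Prop := fun a b =>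
      (∃ p p', D.rel p p' ∧ a = Sum.inl p ∧ b = Sum.inl p') ∨
      ∃ (e : H.E) (i : ℕ) (p : D.P) (u : (σ e).V), (D.att e)[i]? = some p ∧ (σ e).ext[i]? = some u ∧ a = Sum.inl p ∧
        b = Sum.inr ⟨e, u⟩
    have hinl : ∀ p p', D.proj p = D.proj p' →
        Quot.mk R (Sum.inl p) = Quot.mk R (Sum.inl p') := by
      intro p p' h
      exact congrArg (Quot.lift (fun p => Quot.mk R (Sum.inl p))
        fun a b hab => Quot.sound (Or.inl ⟨a, b, hab, rfl, rfl⟩)) (D.mk_eq p p' h)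
    -- An inverse into the quotient of names needs a chosen name for each node of `H`; by `hinl` the
    -- choice does not matter.
    let s := Function.surjInv D.proj_surjective
    have hs : ∀ a, D.proj (s a) = a := Function.surjInv_eq D.proj_surjective
    let back : (H.replaceAll σ).V → Quot R := Quot.lift
      (Sum.elim (fun a => Quot.mk R (Sum.inl (s a))) fun x => Quot.mk R (Sum.inr x)) (by
        rintro _ _ ⟨e, i, a, u, ha, hu⟩
        rw [D.att_eq] at ha
        obtain ⟨p, hp, rfl⟩ := List.exists_of_getElem?_map ha
        exact (hinl _ p (hs _)).trans (Quot.sound (Or.inr ⟨e, i, p, u, hp, hu, rfl, rfl⟩)))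
    have hback : ∀ z, back (Sum.elim (fun p => Quot.mk _ (Sum.inl (D.proj p)))
        (fun x => Quot.mk _ (Sum.inr x)) z) = Quot.mk R z := by
      rintro (p | x)
      · exact hinl _ p (hs _)
      · rfl
    intro p p' h
    exact (hback p).symm.trans ((congrArg back h).trans (hback p'))
  · refine List.nodup_flatMap.2 ⟨fun e _ => List.Nodup.map sigma_mk_injective
      (List.nodup_ofFn.2 (y e).symm.injective), D.edges_nodup.imp fun hne => ?_⟩
    intro x hx hx'
    obtain ⟨_, _, rfl⟩ := List.mem_map.1 hx
    obtain ⟨_, _, h⟩ := List.mem_map.1 hx'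
    exact hne (Sigma.mk.inj h).1.symm
  · rintro ⟨e, x⟩
    refine List.mem_flatMap.2 ⟨e, D.mem_edges e, List.mem_map.2 ⟨x, ?_, rfl⟩⟩
    exact (List.mem_ofFn' _ _).2 ⟨y e x, by simp⟩
  · simp only [NetCode.expand, hz, List.flatMap_map, List.map_flatMap]
    refine congrArg (fun f => List.flatMap f D.edges) (funext fun e => ?_)
    refine List.ext_getElem ?_ fun i h1 h2 => ?_
    · rw [List.length_map, List.length_map]
      refine Eq.trans ?_ (List.length_map _).symm
      exact List.length_ofFn.symm
    have hi : i < (r e).2.1.length := by simpa using h1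
    have := hy e ((y e).symm ⟨i, hi⟩)
    simp only [Equiv.apply_symm_apply, List.get_eq_getElem] at this
    simp [this, LabHypergraph.replaceAll, Function.comp_def]
  · rintro ⟨e, x⟩
    refine Eq.trans ?_ List.map_map.symm
    rfl
  · simp [NetCode.expand, D.ext_name, Function.comp_def]
  · simp [LabHypergraph.replaceAll, D.ext_eq, Function.comp_def]

end Presentation

/-! ### Recognising string graphs from a presentation -/

/-- The value at `k` of the map on `nodes` that is given by the list `φ` of its values. -/
def lookupNode (nodes φ : List ℕ) (k : ℕ) : ℕ := φ.getD (nodes.idxOf k) 0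

/-- All maps from `nodes` to the numbers below `m`, as lists of values. -/
def assignments (nodes : List ℕ) (m : ℕ) : List (List ℕ) :=
  (nodes.map fun _ => List.range m).sections

/-- Repetitions in `nodes` are harmless: the value is read at the first occurrence, and all
occurrences carry the same value. The default `0` is not reached. -/
theorem lookupNode_map {nodes : List ℕ} (g : ℕ → ℕ) {k : ℕ} (hk : k ∈ nodes) :
    lookupNode nodes (nodes.map g) k = g k := by
  have := List.idxOf_lt_length_of_mem hk
  simp [lookupNode, List.getD_eq_getElem?_getD, this]

theorem map_mem_assignments {nodes : List ℕ} {m : ℕ} {g : ℕ → ℕ} (hg : ∀ k ∈ nodes, g k < m) :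
    nodes.map g ∈ assignments nodes m := by
  rw [assignments, List.mem_sections, List.forall₂_map_right_iff, List.forall₂_map_left_iff,
    List.forall₂_same]
  simpa using hg

theorem lookupNode_lt {nodes φ : List ℕ} {m k : ℕ} (hφ : φ ∈ assignments nodes m)
    (hk : k ∈ nodes) : lookupNode nodes φ k < m := by
  rw [assignments, List.mem_sections, List.forall₂_map_right_iff] at hφ
  have hi := List.idxOf_lt_length_of_mem hk
  have hi' : nodes.idxOf k < φ.length := by rwa [hφ.length_eq]
  have := hφ.get hi' hi
  simpa [lookupNode, List.getD_eq_getElem?_getD, hi'] using this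

namespace NetCode

/-- The map `φ` is constant on nodes that `d` identifies. -/
def Respects (d : NetCode) (φ : List ℕ) : Prop :=
  ∀ q ∈ d.2.1, lookupNode d.1 φ q.1 = lookupNode d.1 φ q.2

/-- The map `φ` separates nodes that can be separated by a map that respects `d`. -/
def Separates (d : NetCode) (φ : List ℕ) : Prop :=
  ∀ ψ ∈ assignments d.1 2, d.Respects ψ → ∀ a ∈ d.1, ∀ b ∈ d.1,
    lookupNode d.1 φ a = lookupNode d.1 φ b → lookupNode d.1 ψ a = lookupNode d.1 ψ b

/-- The map `φ` turns `d` into the string graph of `w`. -/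
def MapsToString (d : NetCode) (w φ : List ℕ) : Prop :=
  (∀ j < w.length + 1, ∃ k ∈ d.1, lookupNode d.1 φ k = j) ∧
  d.2.2.1.length = w.length ∧
  (∀ j < w.length, (w.getD j 0, [j, j + 1]) ∈
    d.2.2.1.map fun q => (q.1, q.2.map (lookupNode d.1 φ))) ∧
  d.2.2.2.map (lookupNode d.1 φ) = [0, w.length]

/-- The hypergraph described by `d` is the string graph of `w`. -/
def IsString (d : NetCode) (w : List ℕ) : Prop :=
  ∃ φ ∈ assignments d.1 (w.length + 1), d.Respects φ ∧ d.Separates φ ∧ d.MapsToString w φ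

end NetCode

namespace Presentation

variable {C : Signature} {n : ℕ} {ν : C.Label ≃ Fin n} {d : NetCode} {H : LabHypergraph C}

theorem name_mem (D : Presentation ν d H) (p : D.P) : D.name p ∈ d.1 := (D.mem_nodes _).2 ⟨p, rfl⟩

/-- `Respects` makes `φ` descend to the nodes of `H`, `Separates` makes it injective there, and
`MapsToString` makes it surjective and matches hyperedges and external nodes. -/
theorem isomorphic_of_isString (D : Presentation ν d H) {w : List C.Label}
    (hw : ∀ a ∈ w, C.type a = 2) (h : d.IsString (w.map fun a => (ν a : ℕ))) :
    H.Isomorphic (LabHypergraph.stringGraph w hw) := by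
  classical
  obtain ⟨φ, hφ, hresp, hsep, hsurj, hlen, hedge, hext⟩ := h
  rw [List.length_map] at hφ hsurj hlen hedge hext
  let F : D.P → Fin (w.length + 1) := fun p => ⟨lookupNode d.1 φ (D.name p),
    lookupNode_lt hφ (D.name_mem p)⟩
  have hF : ∀ p p', D.rel p p' → F p = F p' := fun p p' h =>
    Fin.ext (hresp _ ((D.mem_eqs _).2 ⟨p, p', h, rfl⟩))
  have hF' : ∀ p p', F p = F p' → D.proj p = D.proj p' := by
    intro p p' h
    -- The indicator function of the names of one node respects all identifications. Two values thus
    -- suffice to separate distinct nodes, which is why `Separates` only tests maps to `{0, 1}`.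
    let g : ℕ → ℕ := fun k => if ∃ z, D.name z = k ∧ D.proj z = D.proj p then 1 else 0
    have hg : ∀ z, g (D.name z) = if D.proj z = D.proj p then 1 else 0 := by
      intro z
      refine if_congr ⟨?_, fun hz => ⟨z, rfl, hz⟩⟩ rfl rfl
      rintro ⟨z', hz', hz⟩
      rwa [← D.name_injective hz']
    have := hsep (d.1.map g) (map_mem_assignments fun k _ => by simp only [g]; split <;> simp) ?_
      _ (D.name_mem p) _ (D.name_mem p') (congrArg Fin.val h)
    · rw [lookupNode_map _ (D.name_mem p), lookupNode_map _ (D.name_mem p'), hg, hg,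
        if_pos rfl] at this
      by_contra hne
      rw [if_neg (Ne.symm hne)] at this
      exact one_ne_zero this
    · intro q hq
      obtain ⟨z, z', hz, rfl⟩ := (D.mem_eqs q).1 hq
      rw [lookupNode_map _ (D.name_mem z), lookupNode_map _ (D.name_mem z'), hg, hg,
        D.proj_eq z z' hz]
  let s := Function.surjInv D.proj_surjective
  have hs : ∀ a, D.proj (s a) = a := Function.surjInv_eq D.proj_surjective
  let gV : H.V → Fin (w.length + 1) := fun a => F (s a)
  have hgV : ∀ p, gV (D.proj p) = F p := fun p =>
    congrArg (Quot.lift F hF) (D.mk_eq _ _ (hs (D.proj p)))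
  have hbij : Function.Bijective gV := by
    constructor
    · intro a b hab
      rw [← hs a, ← hs b]
      exact hF' _ _ hab
    · intro j
      obtain ⟨k, hk, hj⟩ := hsurj j j.2
      obtain ⟨p, rfl⟩ := (D.mem_nodes k).1 hk
      exact ⟨D.proj p, (hgV p).trans (Fin.ext hj)⟩
  have hmap : ∀ l : List D.P, ((l.map D.name).map (lookupNode d.1 φ)) =
      (((l.map D.proj).map gV).map Fin.val) := by
    intro l
    simp only [List.map_map]
    exact List.map_congr_left fun p _ => (congrArg Fin.val (hgV p)).symm
  have hE : ∀ j : Fin w.length, ∃ e, H.lab e = w.get j ∧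
      ((H.att e).map gV).map Fin.val = [j.1, j.1 + 1] := by
    intro j
    obtain ⟨q, hq, heq⟩ := List.mem_map.1 (hedge j j.2)
    rw [D.edges_eq] at hq
    obtain ⟨e, -, rfl⟩ := List.mem_map.1 hq
    obtain ⟨h1, h2⟩ := Prod.mk.inj heq
    refine ⟨e, ν.injective (Fin.ext (h1.trans ?_)), ?_⟩
    · simp [List.getD_eq_getElem?_getD]
    · rw [D.att_eq, ← hmap, h2]
  choose gE hlab hatt using hE
  -- Different positions have different attachments; as the numbers of hyperedges agree, injectivity
  -- gives a bijection.
  have hinj : Function.Injective gE := by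
    intro j j' h
    have := (hatt j).symm.trans ((congrArg (fun e => ((H.att e).map gV).map Fin.val) h).trans
      (hatt j'))
    simp only [List.cons.injEq] at this
    exact Fin.ext this.1
  have hcard : Nat.card H.E = w.length := by
    rw [← hlen, D.edges_eq, List.length_map, ← List.toFinset_card_of_nodup D.edges_nodup,
      ← Nat.subtype_card (p := fun _ => True) _ fun x => by simp [D.mem_edges x]]
    exact Nat.card_congr (Equiv.subtypeUnivEquiv fun _ => trivial).symm
  have hEbij : Function.Bijective gE := by
    have := H.finite_E
    have := Fintype.ofFinite H.E
    refine (Fintype.bijective_iff_injective_and_card gE).2 ⟨hinj, ?_⟩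
    rw [Fintype.card_fin, ← hcard, Nat.card_eq_fintype_card]
  have hkey : ∀ j, (H.att (gE j)).map gV = [j.castSucc, j.succ] := fun j =>
    List.map_injective_iff.2 Fin.val_injective (hatt j)
  refine LabHypergraph.Isomorphic.symm ⟨(Equiv.ofBijective gV hbij).symm,
    Equiv.ofBijective gE hEbij, ?_, hlab, ?_⟩
  · intro j
    refine List.map_injective_iff.2 hbij.1 ?_
    rw [List.map_map]
    refine (hkey j).trans ?_
    have : gV ∘ (Equiv.ofBijective gV hbij).symm = id :=
      funext fun x => (Equiv.ofBijective gV hbij).apply_symm_apply x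
    exact (this ▸ List.map_id _).symm
  · refine List.map_injective_iff.2 hbij.1 ?_
    rw [List.map_map]
    have : gV ∘ (Equiv.ofBijective gV hbij).symm = id :=
      funext fun x => (Equiv.ofBijective gV hbij).apply_symm_apply x
    refine Eq.trans ?_ (this ▸ List.map_id _).symm
    refine List.map_injective_iff.2 Fin.val_injective ?_
    rw [D.ext_eq, ← hmap, ← D.ext_name, hext]
    simp [LabHypergraph.stringGraph]

/-- The isomorphism, read on names, is the required map. It separates because names with equal
images stand for one node, on which every respecting map is constant. -/
theorem isString_of_isomorphic (D : Presentation ν d H) {w : List C.Label}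
    (hw : ∀ a ∈ w, C.type a = 2) (h : H.Isomorphic (LabHypergraph.stringGraph w hw)) :
    d.IsString (w.map fun a => (ν a : ℕ)) := by
  classical
  obtain ⟨gV, gE, h1, h2, h3⟩ := h
  let g : ℕ → ℕ := fun k =>
    if h : ∃ p, D.name p = k then Fin.val (n := w.length + 1) (gV (D.proj h.choose)) else 0
  have hg : ∀ p, g (D.name p) = Fin.val (n := w.length + 1) (gV (D.proj p)) := by
    intro p
    have hex : ∃ p', D.name p' = D.name p := ⟨p, rfl⟩
    simp only [g, dif_pos hex, D.name_injective hex.choose_spec]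
  have hlk : ∀ p, lookupNode d.1 (d.1.map g) (D.name p) =
      Fin.val (n := w.length + 1) (gV (D.proj p)) := fun p =>
    (lookupNode_map _ (D.name_mem p)).trans (hg p)
  have hmap : ∀ l : List D.P, (l.map D.name).map (lookupNode d.1 (d.1.map g)) =
      ((l.map D.proj).map gV).map (Fin.val (n := w.length + 1)) := by
    intro l
    refine List.map_map.trans (Eq.trans ?_ (congrArg (List.map _) List.map_map.symm))
    refine Eq.trans ?_ List.map_map.symm
    exact List.map_congr_left fun p _ => hlk p
  refine ⟨d.1.map g, map_mem_assignments fun k hk => ?_, ?_, ?_, ?_, ?_, ?_, ?_⟩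
  · obtain ⟨p, rfl⟩ := (D.mem_nodes k).1 hk
    rw [hg, List.length_map]
    exact Fin.is_lt _
  · intro q hq
    obtain ⟨z, z', hz, rfl⟩ := (D.mem_eqs q).1 hq
    rw [hlk, hlk, D.proj_eq z z' hz]
  · intro ψ _ hψ a ha b hb hab
    obtain ⟨p, rfl⟩ := (D.mem_nodes a).1 ha
    obtain ⟨p', rfl⟩ := (D.mem_nodes b).1 hb
    rw [hlk, hlk] at hab
    exact congrArg (Quot.lift (fun p => lookupNode d.1 ψ (D.name p)) fun z z' hz =>
      hψ _ ((D.mem_eqs _).2 ⟨z, z', hz, rfl⟩)) (D.mk_eq _ _ (gV.injective (Fin.ext hab)))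
  · intro j hj
    rw [List.length_map] at hj
    obtain ⟨p, hp⟩ := D.proj_surjective (gV.symm (⟨j, hj⟩ : Fin (w.length + 1)))
    refine ⟨D.name p, D.name_mem p, ?_⟩
    rw [hlk, hp]
    exact congrArg (Fin.val (n := w.length + 1)) (gV.apply_symm_apply _)
  · have hcard : Nat.card H.E = D.edges.length := by
      rw [← List.toFinset_card_of_nodup D.edges_nodup,
        ← Nat.subtype_card (p := fun _ => True) _ fun x => by simp [D.mem_edges x]]
      exact Nat.card_congr (Equiv.subtypeUnivEquiv fun _ => trivial).symm
    rw [D.edges_eq, List.length_map, ← hcard, List.length_map, Nat.card_congr gE]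
    exact Nat.card_fin _
  · intro j hj
    rw [List.length_map] at hj
    let e : H.E := gE.symm (⟨j, hj⟩ : Fin w.length)
    have he : gE e = (⟨j, hj⟩ : Fin w.length) := Equiv.apply_symm_apply _ _
    rw [D.edges_eq, List.map_map]
    refine List.mem_map.2 ⟨e, D.mem_edges e, Prod.ext ?_ ?_⟩
    · change (ν (H.lab e) : ℕ) = _
      rw [← h2 e, he]
      simp [LabHypergraph.stringGraph, List.getD_eq_getElem?_getD, hj]
    · refine (hmap _).trans ?_
      rw [← D.att_eq, ← h1 e, he]
      rfl
  · rw [D.ext_name, hmap, ← D.ext_eq, ← h3, List.length_map]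
    rfl

theorem isString_iff (D : Presentation ν d H) {w : List C.Label} (hw : ∀ a ∈ w, C.type a = 2) :
    d.IsString (w.map fun a => (ν a : ℕ)) ↔
      H.Isomorphic (LabHypergraph.stringGraph w hw) :=
  ⟨D.isomorphic_of_isString hw, D.isString_of_isomorphic hw⟩

/-! ### Derivations carried out on presentations -/

variable {𝒯 : Set (Set (C.Label × LabHypergraph C))} {tabs : List (List RuleCode)}

/-- Since `edges` has no repetitions, a list of rule choices is the same as a function on the
hyperedges, as `replaceAll` requires. -/
theorem exists_of_mem_step (D : Presentation ν d H)
    (htabs : DescribesSet (DescribesSet (RuleCode.Describes ν)) tabs 𝒯) {d' : NetCode}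
    (hd' : d' ∈ d.step tabs) :
    ∃ T ∈ 𝒯, ∃ σ : H.E → LabHypergraph C, (∀ e, (H.lab e, σ e) ∈ T) ∧
      Nonempty (Presentation ν d' (H.replaceAll σ)) := by
  obtain ⟨tab, htab, hd'⟩ := List.mem_flatMap.1 hd'
  obtain ⟨ch, hch, rfl⟩ := List.mem_map.1 hd'
  obtain ⟨T, hT, hdesc⟩ := htabs.1 tab htab
  refine ⟨T, hT, ?_⟩
  rw [ruleChoices, List.mem_sections, List.forall₂_map_right_iff, D.edges_eq,
    List.forall₂_map_right_iff] at hch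
  obtain ⟨g, rfl, hg⟩ := hch.exists_eq_map D.edges_nodup
  have hr : ∀ e, ∃ r ∈ tab, r.1 = ν (H.lab e) ∧ ((D.att e).map D.name, r.2) = g e := by
    intro e
    obtain ⟨r, hr, hre⟩ := List.mem_map.1 (hg e (D.mem_edges e))
    obtain ⟨h1, h2⟩ := List.mem_filter.1 hr
    exact ⟨r, h1, by simpa using h2, hre⟩
  choose r hr1 hr2 hr3 using hr
  have hσ : ∀ e, ∃ R, (H.lab e, R) ∈ T ∧ (r e).2.Describes ν R := by
    intro e
    obtain ⟨⟨X, R⟩, hX, h1, h2⟩ := hdesc.1 _ (hr1 e)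
    obtain rfl : X = H.lab e := ν.injective (Fin.ext (h1.symm.trans (hr2 e)))
    exact ⟨R, hX, h2⟩
  choose σ hσ1 hσ2 using hσ
  refine ⟨σ, hσ1, ?_⟩
  obtain rfl : g = fun e => ((D.att e).map D.name, (r e).2) := funext fun e => (hr3 e).symm
  exact D.nonempty_expand σ (fun e => (r e).2) hσ2

theorem exists_mem_step (D : Presentation ν d H)
    (htabs : DescribesSet (DescribesSet (RuleCode.Describes ν)) tabs 𝒯)
    {T : Set (C.Label × LabHypergraph C)} (hT : T ∈ 𝒯) {σ : H.E → LabHypergraph C}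
    (hσ : ∀ e, (H.lab e, σ e) ∈ T) :
    ∃ d' ∈ d.step tabs, Nonempty (Presentation ν d' (H.replaceAll σ)) := by
  obtain ⟨tab, htab, hdesc⟩ := htabs.2 T hT
  choose r hr1 hr2 using fun e => hdesc.2 _ (hσ e)
  refine ⟨_, List.mem_flatMap.2 ⟨tab, htab, List.mem_map.2 ⟨_, ?_, rfl⟩⟩,
    D.nonempty_expand σ (fun e => (r e).2) fun e => (hr2 e).2⟩
  rw [ruleChoices, List.mem_sections, List.forall₂_map_right_iff, D.edges_eq,
    List.forall₂_map_right_iff, List.forall₂_map_left_iff, List.forall₂_same]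
  intro e _
  refine List.mem_map.2 ⟨r e, List.mem_filter.2 ⟨hr1 e, ?_⟩, rfl⟩
  simpa using (hr2 e).1

end Presentation

/-- `steps` appends its last step, whereas `DerivesIn` peels off the first; this turns one recursion
into the other. -/
theorem NetCode.mem_steps_succ {tabs : List (List RuleCode)} {d d' : NetCode} {t : ℕ} :
    d' ∈ d.steps tabs (t + 1) ↔ ∃ d₁ ∈ d.step tabs, d' ∈ d₁.steps tabs t := by
  induction t generalizing d' with
  | zero => simp [NetCode.steps]
  | succ t ih =>
    constructor
    · intro h
      obtain ⟨d₂, h2, h⟩ := List.mem_flatMap.1 (show d' ∈ (d.steps tabs (t + 1)).flatMap _ from h)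
      obtain ⟨d₁, h1, h2⟩ := ih.1 h2
      exact ⟨d₁, h1, List.mem_flatMap.2 ⟨d₂, h2, h⟩⟩
    · rintro ⟨d₁, h1, h⟩
      obtain ⟨d₂, h2, h⟩ := List.mem_flatMap.1 (show d' ∈ (d₁.steps tabs t).flatMap _ from h)
      exact List.mem_flatMap.2 ⟨d₂, ih.2 ⟨d₁, h1, h2⟩, h⟩

namespace Presentation

variable {C : Signature} {n : ℕ} {ν : C.Label ≃ Fin n} {d : NetCode} {H : LabHypergraph C}
  {𝒯 : Set (Set (C.Label × LabHypergraph C))} {tabs : List (List RuleCode)}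

/-- The derivations of a string graph in `t` steps are found by `NetCode.steps`. -/
theorem exists_isString_iff (D : Presentation ν d H)
    (htabs : DescribesSet (DescribesSet (RuleCode.Describes ν)) tabs 𝒯) {w : List C.Label}
    (hw : ∀ a ∈ w, C.type a = 2) (t : ℕ) :
    (∃ d' ∈ d.steps tabs t, d'.IsString (w.map fun a => (ν a : ℕ))) ↔
      ∃ τ : List (Set (C.Label × LabHypergraph C)), (∀ T ∈ τ, T ∈ 𝒯) ∧ τ.length = t ∧
        LabHypergraph.DerivesIn τ H (LabHypergraph.stringGraph w hw) := by
  induction t generalizing d H with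
  | zero =>
    change (∃ d' ∈ [d], d'.IsString _) ↔ _
    simp only [List.mem_singleton, exists_eq_left, List.length_eq_zero_iff]
    rw [D.isString_iff hw]
    constructor
    · exact fun h => ⟨[], by simp, rfl, h⟩
    · rintro ⟨_, -, rfl, h⟩
      exact h
  | succ t ih =>
    constructor
    · rintro ⟨d', hd', hs⟩
      obtain ⟨d₁, h1, h2⟩ := NetCode.mem_steps_succ.1 hd'
      obtain ⟨T, hT, σ, hσ, ⟨D₁⟩⟩ := D.exists_of_mem_step htabs h1
      obtain ⟨τ, hτ, hlen, h⟩ := (ih D₁).1 ⟨d', h2, hs⟩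
      exact ⟨T :: τ, by simpa using ⟨hT, hτ⟩, by simp [hlen], σ, hσ, h⟩
    · rintro ⟨_ | ⟨T, τ⟩, hτ, hlen, h⟩
      · simp at hlen
      · obtain ⟨σ, hσ, h⟩ := h
        obtain ⟨d₁, h1, ⟨D₁⟩⟩ := D.exists_mem_step htabs (hτ T (by simp)) hσ
        obtain ⟨d', h2, hs⟩ := (ih D₁).2 ⟨τ, fun T hT => hτ T (by simp [hT]), by simpa using hlen, h⟩
        exact ⟨d', NetCode.mem_steps_succ.2 ⟨d₁, h1, h2⟩, hs⟩

end Presentation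

/-! ### The decision procedure and its correctness -/

/-- The number of derivation steps that suffice for a word of length `l`, where `ts` are the types
of the labels. -/
def stepBound (ts : List ℕ) (l : ℕ) : ℕ :=
  derivationBound ts.length (ts.foldr max 0) (l + 1)

/-- The decision procedure for membership in the string language of a grammar. -/
def GrammarCode.Accepts (c : GrammarCode) (w : List ℕ) : Prop :=
  (∀ a ∈ w, c.1.getD a 0 = 2 ∧ a ∈ c.2.1) ∧
  ∃ t < stepBound c.1 w.length + 1,
    ∃ d ∈ (NetCode.handle c.2.2.1 (c.1.getD c.2.2.1 0)).steps c.2.2.2 t, d.IsString w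

theorem LabHypergraph.small_stringGraph {C : Signature} (w : List C.Label)
    (hw : ∀ a ∈ w, C.type a = 2) :
    (LabHypergraph.stringGraph w hw).Small (w.length + 1) := by
  constructor
  · refine (Nat.card_le_card_of_injective (β := Fin (w.length + 1)) Subtype.val
      Subtype.val_injective).trans ?_
    simp
  · exact (Nat.card_fin _).trans_le (Nat.le_succ _)

/-- Soundness holds for any number of steps. Completeness uses that the string graph of `w` is small
for `b = w.length + 1`, its number of nodes, so that a derivation within `stepBound` exists. -/
theorem GrammarCode.accepts_iff {C : Signature} {G : PHRGrammar C} {n : ℕ} {ν : C.Label ≃ Fin n}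
    {c : GrammarCode} (hc : c.Describes ν G) (w : List C.Label) :
    c.Accepts (w.map fun a => (ν a : ℕ)) ↔ w ∈ STR G.language := by
  obtain ⟨ts, as, s, tabs⟩ := c
  obtain ⟨hts, has, hs, htabs⟩ := hc
  have htype : ∀ X : C.Label, ts.getD (ν X) 0 = C.type X := by
    intro X
    simp [hts, List.getD_eq_getElem?_getD]
  have hterm : ∀ X : C.Label, (ν X : ℕ) ∈ as ↔ X ∈ G.terminals := by
    intro X
    constructor
    · intro h
      obtain ⟨Y, hY, h⟩ := has.1 _ h
      rwa [ν.injective (Fin.ext h)]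
    · intro h
      obtain ⟨a, ha, h⟩ := has.2 X h
      rwa [← h]
  have hmax : ∀ X : C.Label, C.type X ≤ ts.foldr max 0 := by
    intro X
    rw [← htype]
    have hX : (ν X : ℕ) < ts.length := by simp [hts]
    rw [List.getD_eq_getElem _ _ hX]
    exact List.le_max_of_le (List.getElem_mem hX) le_rfl
  have hcard : Nat.card C.Label = ts.length := by
    rw [hts, List.length_ofFn, Nat.card_congr ν, Nat.card_fin]
  have hstart : NetCode.handle s (ts.getD s 0) =
      NetCode.handle (ν G.start) (C.type G.start) := by
    rw [hs, htype]
  simp only [GrammarCode.Accepts, List.forall_mem_map, htype, hterm, hstart, List.length_map]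
  constructor
  · rintro ⟨hw, t, -, h⟩
    have hw2 : ∀ a ∈ w, C.type a = 2 := fun a ha => (hw a ha).1
    obtain ⟨τ, hτ, -, h⟩ :=
      ((Presentation.ofHandle ν G.start).exists_isString_iff htabs hw2 t).1 h
    refine ⟨LabHypergraph.stringGraph w hw2, ⟨LabHypergraph.derives_iff.2 ⟨τ, hτ, h⟩, ?_⟩,
      hw2, LabHypergraph.Isomorphic.refl _⟩
    intro i
    exact (hw _ (w.get_mem i)).2
  · rintro ⟨H, ⟨hH, hlab⟩, hw2, hiso⟩
    obtain ⟨τ, hτ, hH⟩ := LabHypergraph.derives_iff.1 hH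
    refine ⟨fun a ha => ⟨hw2 a ha, ?_⟩, ?_⟩
    · obtain ⟨gV, gE, h1, h2, h3⟩ := hiso.symm
      obtain ⟨i, hi⟩ := List.mem_iff_get.1 ha
      have := hlab (gE i)
      rwa [show H.lab (gE i) = w.get i from h2 i, hi] at this
    · have hT : ∀ T ∈ τ, IsTable T := fun T hT => G.isTable T (hτ T hT)
      have hW : LabHypergraph.DerivesIn τ (LabHypergraph.handle G.start)
          (LabHypergraph.stringGraph w hw2) := by
        rw [LabHypergraph.derivesIn_handle_iff hT] at hH ⊢
        exact LabHypergraph.yield_congr hiso hH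
      obtain ⟨τ', h1, h2, h3⟩ := LabHypergraph.exists_short_derivation hmax hT hτ
        (LabHypergraph.small_stringGraph w hw2) hW
      rw [hcard] at h2
      exact ⟨τ'.length, Nat.lt_succ_of_le h2,
        ((Presentation.ofHandle ν G.start).exists_isString_iff htabs hw2 _).2 ⟨τ', h1, rfl, h3⟩⟩

/-! ### Primitive recursiveness of the procedure -/

section PrimrecLemmas

variable {α β γ σ : Type*} [Primcodable α] [Primcodable β] [Primcodable γ] [Primcodable σ]

theorem PrimrecPred.exists_mem {f : α → List β} {p : α → β → Prop} (hf : Primrec f)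
    (hp : PrimrecPred fun x : α × β => p x.1 x.2) : PrimrecPred fun a => ∃ b ∈ f a, p a b := by
  have : PrimrecRel fun (b : β) (a : α) => p a b :=
    PrimrecPred.primrecRel (PrimrecPred.comp hp (Primrec.snd.pair Primrec.fst))
  exact this.exists_mem_list.comp hf Primrec.id

theorem PrimrecPred.forall_mem {f : α → List β} {p : α → β → Prop} (hf : Primrec f)
    (hp : PrimrecPred fun x : α × β => p x.1 x.2) : PrimrecPred fun a => ∀ b ∈ f a, p a b := by
  have : PrimrecRel fun (b : β) (a : α) => p a b :=
    PrimrecPred.primrecRel (PrimrecPred.comp hp (Primrec.snd.pair Primrec.fst))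
  exact this.forall_mem_list.comp hf Primrec.id

theorem PrimrecPred.exists_lt_of {f : α → ℕ} {p : α → ℕ → Prop} (hf : Primrec f)
    (hp : PrimrecPred fun x : α × ℕ => p x.1 x.2) : PrimrecPred fun a => ∃ b < f a, p a b :=
  (PrimrecPred.exists_mem (Primrec.list_range.comp hf) hp).of_eq fun a => by simp

theorem PrimrecPred.forall_lt_of {f : α → ℕ} {p : α → ℕ → Prop} (hf : Primrec f)
    (hp : PrimrecPred fun x : α × ℕ => p x.1 x.2) : PrimrecPred fun a => ∀ b < f a, p a b :=
  (PrimrecPred.forall_mem (Primrec.list_range.comp hf) hp).of_eq fun a => by simp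

theorem PrimrecPred.mem_list {f : α → β} {g : α → List β} (hf : Primrec f) (hg : Primrec g) :
    PrimrecPred fun a => f a ∈ g a := by
  classical
  have : PrimrecPred fun x : α × β => x.2 = f x.1 :=
    Primrec.eq.comp Primrec.snd (hf.comp Primrec.fst)
  exact (PrimrecPred.exists_mem (p := fun a b => b = f a) hg this).of_eq fun a => by simp

theorem Primrec.list_zipIdx {f : α → List β} (hf : Primrec f) :
    Primrec fun a => (f a).zipIdx := by
  have h : Primrec fun a => (List.range (f a).length).filterMap fun i =>
      ((f a)[i]?).map fun b => (b, i) := by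
    refine Primrec.listFilterMap (Primrec.list_range.comp (Primrec.list_length.comp hf)) ?_
    refine Primrec.option_map
      (Primrec.list_getElem?.comp (hf.comp Primrec.fst) Primrec.snd) ?_
    exact Primrec.snd.pair (Primrec.snd.comp Primrec.fst)
  refine h.of_eq fun a => ?_
  have : ∀ i ∈ List.range (f a).length, (((f a)[i]?).map fun b => (b, i)) = (f a).zipIdx[i]? := by
    intro i hi
    simp
  rw [List.filterMap_congr this]
  have hlen : (f a).length = (f a).zipIdx.length := by simp
  rw [hlen]
  generalize (f a).zipIdx = l
  refine List.ext_getElem? fun i => ?_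
  have h2 : (List.range l.length).map (fun i => l[i]?) = l.map some := by
    refine List.ext_getElem (by simp) fun i h1 h2 => ?_
    have : i < l.length := by simpa using h2
    simp [this]
  have h3 : (List.range l.length).filterMap (fun i => l[i]?) =
      ((List.range l.length).map fun i => l[i]?).filterMap id := by
    rw [List.filterMap_map]
    rfl
  rw [h3, h2]
  simp

theorem Primrec.list_zip {f : α → List β} {g : α → List γ} (hf : Primrec f) (hg : Primrec g) :
    Primrec fun a => (f a).zip (g a) := by
  have h : Primrec fun a => (f a).zipIdx.filterMap fun p =>
      ((g a)[p.2]?).map fun c => (p.1, c) := by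
    refine Primrec.listFilterMap (Primrec.list_zipIdx hf) ?_
    refine Primrec.option_map
      (Primrec.list_getElem?.comp (hg.comp Primrec.fst) (Primrec.snd.comp Primrec.snd)) ?_
    exact (Primrec.fst.comp (Primrec.snd.comp Primrec.fst)).pair Primrec.snd
  refine h.of_eq fun a => ?_
  generalize f a = l
  generalize g a = l'
  -- The induction needs an arbitrary starting index. Lookups past the end of `l'` fail and are
  -- dropped, just as `zip` truncates.
  have key : ∀ (l : List β) (k : ℕ), (l.zipIdx k).filterMap (fun p =>
      (l'[p.2]?).map fun c => (p.1, c)) = l.zip (l'.drop k) := by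
    intro l
    induction l with
    | nil => simp
    | cons b l ih =>
      intro k
      rw [List.zipIdx_cons, List.filterMap_cons, ih]
      by_cases hk : k < l'.length
      · rw [List.drop_eq_getElem_cons hk, List.zip_cons_cons]
        simp [hk]
      · rw [List.drop_eq_nil_of_le (by omega : l'.length ≤ k)]
        simp [List.getElem?_eq_none (by omega : l'.length ≤ k),
          List.drop_eq_nil_of_le (by omega : l'.length ≤ k + 1)]
  simpa using key l 0

theorem Primrec.list_sections : Primrec (List.sections : List (List β) → List (List β)) := by
  have h : Primrec fun L : List (List β) => L.foldr
      (fun l s => s.flatMap fun t => l.map fun b => b :: t) [[]] := by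
    refine Primrec.list_foldr (h := fun _ (x : List β × List (List β)) =>
      x.2.flatMap fun t => x.1.map fun b => b :: t) Primrec.id (Primrec.const [[]]) ?_
    refine Primrec.list_flatMap (Primrec.snd.comp Primrec.snd) ?_
    refine Primrec.list_map (Primrec.fst.comp (Primrec.snd.comp Primrec.fst)) ?_
    exact Primrec.list_cons.comp Primrec.snd (Primrec.snd.comp Primrec.fst)
  refine h.of_eq fun L => ?_
  induction L with
  | nil => rfl
  | cons l L ih => rw [List.foldr_cons, ih]; rfl

theorem Primrec.nat_pow' {f g : α → ℕ} (hf : Primrec f) (hg : Primrec g) :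
    Primrec fun a => f a ^ g a :=
  (Primrec₂.unpaired'.1 Nat.Primrec.pow).comp hf hg

end PrimrecLemmas

section

variable {α : Type*} [Primcodable α]

theorem primrec_derivationBound {q K b : α → ℕ} (hq : Primrec q) (hK : Primrec K)
    (hb : Primrec b) : Primrec fun a => derivationBound (q a) (K a) (b a) := by
  have hbK := Primrec.nat_add.comp hb hK
  have h1 := Primrec.nat_pow' (Primrec.succ.comp hbK) hK
  have h2 := Primrec.nat_pow' (Primrec.succ.comp (Primrec.nat_mul.comp hq h1)) hb
  have h3 := Primrec.nat_pow' (Primrec.const 2) hbK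
  exact Primrec.nat_pow' (Primrec.nat_pow' (Primrec.const 2)
    (Primrec.nat_mul.comp h3 (Primrec.nat_mul.comp h2 h1))) hq

theorem primrec_stepBound {ts : α → List ℕ} {l : α → ℕ} (hts : Primrec ts) (hl : Primrec l) :
    Primrec fun a => stepBound (ts a) (l a) := by
  refine primrec_derivationBound (Primrec.list_length.comp hts) ?_ (Primrec.succ.comp hl)
  exact Primrec.list_foldr (h := fun _ (x : ℕ × ℕ) => max x.1 x.2) hts (Primrec.const 0)
    (Primrec.nat_max.comp (Primrec.fst.comp Primrec.snd) (Primrec.snd.comp Primrec.snd))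

theorem primrec_map_pair {f : α → ℕ} {g : α → List ℕ} (hf : Primrec f) (hg : Primrec g) :
    Primrec fun a => (g a).map (Nat.pair (f a)) :=
  Primrec.list_map hg (Primrec₂.natPair.comp (hf.comp Primrec.fst) Primrec.snd)

theorem primrec_expand {d : α → NetCode} {ch : α → List (List ℕ × HypergraphCode)}
    (hd : Primrec d) (hch : Primrec ch) : Primrec fun a => (d a).expand (ch a) := by
  have hz := Primrec.list_zipIdx hch
  have h2 : Primrec fun x : α × (List ℕ × HypergraphCode) × ℕ => x.2.2 + 1 :=
    Primrec.succ.comp (Primrec.snd.comp Primrec.snd)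
  have hatt : Primrec fun x : α × (List ℕ × HypergraphCode) × ℕ => x.2.1.1 :=
    Primrec.fst.comp (Primrec.fst.comp Primrec.snd)
  have hcode : Primrec fun x : α × (List ℕ × HypergraphCode) × ℕ => x.2.1.2 :=
    Primrec.snd.comp (Primrec.fst.comp Primrec.snd)
  have heq := Primrec.fst.comp (Primrec.snd.comp hd)
  refine Primrec.pair ?_ (Primrec.pair ?_ (Primrec.pair ?_ ?_))
  · refine Primrec.list_append.comp (primrec_map_pair (Primrec.const 0) (Primrec.fst.comp hd)) ?_
    exact Primrec.list_flatMap hz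
      (primrec_map_pair h2 (Primrec.list_range.comp (Primrec.fst.comp hcode)))
  · refine Primrec.list_append.comp (Primrec.list_map heq (Primrec.pair ?_ ?_)) ?_
    · exact Primrec₂.natPair.comp (Primrec.const 0) (Primrec.fst.comp Primrec.snd)
    · exact Primrec₂.natPair.comp (Primrec.const 0) (Primrec.snd.comp Primrec.snd)
    · exact Primrec.list_flatMap hz (Primrec.list_zip
        (primrec_map_pair (Primrec.const 0) hatt)
        (primrec_map_pair h2 (Primrec.snd.comp (Primrec.snd.comp hcode))))
  · refine Primrec.list_flatMap hz (Primrec.list_map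
      (Primrec.fst.comp (Primrec.snd.comp hcode)) (Primrec.pair ?_ ?_))
    · exact Primrec.fst.comp Primrec.snd
    · exact primrec_map_pair (h2.comp Primrec.fst) (Primrec.snd.comp Primrec.snd)
  · exact primrec_map_pair (Primrec.const 0)
      (Primrec.snd.comp (Primrec.snd.comp (Primrec.snd.comp hd)))

theorem primrec_ruleChoices {tab : α → List RuleCode} {es : α → List (ℕ × List ℕ)}
    (htab : Primrec tab) (hes : Primrec es) : Primrec fun a => ruleChoices (tab a) (es a) := by
  refine Primrec.list_sections.comp (Primrec.list_map hes (Primrec.list_map ?_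
    (Primrec.pair (Primrec.snd.comp (Primrec.snd.comp Primrec.fst))
      (Primrec.snd.comp Primrec.snd))))
  have : PrimrecRel fun (r : RuleCode) (q : ℕ × List ℕ) => r.1 = q.1 :=
    PrimrecPred.primrecRel (Primrec.eq.comp (Primrec.fst.comp Primrec.fst)
      (Primrec.fst.comp Primrec.snd))
  exact this.listFilter.comp (htab.comp Primrec.fst) Primrec.snd

theorem primrec_step {tabs : α → List (List RuleCode)} {d : α → NetCode}
    (htabs : Primrec tabs) (hd : Primrec d) : Primrec fun a => (d a).step (tabs a) := by
  refine Primrec.list_flatMap htabs (Primrec.list_map (primrec_ruleChoices Primrec.snd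
    (Primrec.fst.comp (Primrec.snd.comp (Primrec.snd.comp (hd.comp Primrec.fst))))) ?_)
  exact primrec_expand (hd.comp (Primrec.fst.comp Primrec.fst)) Primrec.snd

theorem primrec_steps {tabs : α → List (List RuleCode)} {d : α → NetCode} {t : α → ℕ}
    (htabs : Primrec tabs) (hd : Primrec d) (ht : Primrec t) :
    Primrec fun a => (d a).steps (tabs a) (t a) := by
  refine Primrec.nat_rec' (h := fun a (p : ℕ × List NetCode) =>
    p.2.flatMap (NetCode.step (tabs a))) ht
    (Primrec.list_cons.comp hd (Primrec.const [])) ?_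
  exact Primrec.list_flatMap (Primrec.snd.comp Primrec.snd)
    (primrec_step (htabs.comp (Primrec.fst.comp Primrec.fst)) Primrec.snd)

theorem primrec_lookupNode {nodes φ : α → List ℕ} {k : α → ℕ} (hnodes : Primrec nodes)
    (hφ : Primrec φ) (hk : Primrec k) : Primrec fun a => lookupNode (nodes a) (φ a) (k a) :=
  (Primrec.list_getD 0).comp hφ (Primrec.list_idxOf.comp hk hnodes)

theorem primrec_assignments {nodes : α → List ℕ} {m : α → ℕ} (hnodes : Primrec nodes)
    (hm : Primrec m) : Primrec fun a => assignments (nodes a) (m a) :=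
  Primrec.list_sections.comp (Primrec.list_map hnodes
    (Primrec.list_range.comp (hm.comp Primrec.fst)))

variable {d : α → NetCode} {φ w : α → List ℕ}

theorem primrecPred_respects (hd : Primrec d) (hφ : Primrec φ) :
    PrimrecPred fun a => (d a).Respects (φ a) := by
  refine PrimrecPred.forall_mem (Primrec.fst.comp (Primrec.snd.comp hd)) (Primrec.eq.comp ?_ ?_)
  · exact primrec_lookupNode (Primrec.fst.comp (hd.comp Primrec.fst)) (hφ.comp Primrec.fst)
      (Primrec.fst.comp Primrec.snd)
  · exact primrec_lookupNode (Primrec.fst.comp (hd.comp Primrec.fst)) (hφ.comp Primrec.fst)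
      (Primrec.snd.comp Primrec.snd)

theorem PrimrecPred.imp {p q : α → Prop} (hp : PrimrecPred p) (hq : PrimrecPred q) :
    PrimrecPred fun a => p a → q a :=
  (hp.not.or hq).of_eq fun a => by tauto

theorem primrecPred_separates (hd : Primrec d) (hφ : Primrec φ) :
    PrimrecPred fun a => (d a).Separates (φ a) := by
  have hn := Primrec.fst.comp hd
  refine PrimrecPred.forall_mem (primrec_assignments hn (Primrec.const 2)) ?_
  refine PrimrecPred.imp (primrecPred_respects (hd.comp Primrec.fst) Primrec.snd) ?_
  refine PrimrecPred.forall_mem (hn.comp Primrec.fst) ?_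
  refine PrimrecPred.forall_mem (hn.comp (Primrec.fst.comp Primrec.fst)) ?_
  have hn' := hn.comp (Primrec.fst.comp (Primrec.fst.comp (Primrec.fst (α := (α × List ℕ) × ℕ)
    (β := ℕ))))
  have hφ' := hφ.comp (Primrec.fst.comp (Primrec.fst.comp (Primrec.fst (α := (α × List ℕ) × ℕ)
    (β := ℕ))))
  have hψ := Primrec.snd.comp (Primrec.fst.comp (Primrec.fst (α := (α × List ℕ) × ℕ) (β := ℕ)))
  have ha := Primrec.snd.comp (Primrec.fst (α := (α × List ℕ) × ℕ) (β := ℕ))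
  exact PrimrecPred.imp
    (Primrec.eq.comp (primrec_lookupNode hn' hφ' ha) (primrec_lookupNode hn' hφ' Primrec.snd))
    (Primrec.eq.comp (primrec_lookupNode hn' hψ ha) (primrec_lookupNode hn' hψ Primrec.snd))

theorem primrec_map_lookupNode {nodes φ l : α → List ℕ} (hnodes : Primrec nodes)
    (hφ : Primrec φ) (hl : Primrec l) :
    Primrec fun a => (l a).map (lookupNode (nodes a) (φ a)) :=
  Primrec.list_map hl (primrec_lookupNode (hnodes.comp Primrec.fst) (hφ.comp Primrec.fst)
    Primrec.snd)

theorem primrecPred_mapsToString (hd : Primrec d) (hw : Primrec w) (hφ : Primrec φ) :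
    PrimrecPred fun a => (d a).MapsToString (w a) (φ a) := by
  have hn := Primrec.fst.comp hd
  have hes := Primrec.fst.comp (Primrec.snd.comp (Primrec.snd.comp hd))
  have hlen := Primrec.list_length.comp hw
  refine PrimrecPred.and ?_ (PrimrecPred.and ?_ (PrimrecPred.and ?_ ?_))
  · refine PrimrecPred.forall_lt_of (Primrec.succ.comp hlen) ?_
    refine PrimrecPred.exists_mem (hn.comp Primrec.fst) (Primrec.eq.comp ?_ ?_)
    · exact primrec_lookupNode (hn.comp (Primrec.fst.comp Primrec.fst))
        (hφ.comp (Primrec.fst.comp Primrec.fst)) Primrec.snd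
    · exact Primrec.snd.comp Primrec.fst
  · exact Primrec.eq.comp (Primrec.list_length.comp hes) hlen
  · refine PrimrecPred.forall_lt_of hlen (PrimrecPred.mem_list (Primrec.pair ?_ ?_) ?_)
    · exact (Primrec.list_getD 0).comp (hw.comp Primrec.fst) Primrec.snd
    · exact Primrec.list_cons.comp Primrec.snd
        (Primrec.list_cons.comp (Primrec.succ.comp Primrec.snd) (Primrec.const []))
    · refine Primrec.list_map (hes.comp Primrec.fst)
        (Primrec.pair (Primrec.fst.comp Primrec.snd) ?_)
      exact primrec_map_lookupNode (hn.comp (Primrec.fst.comp Primrec.fst))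
        (hφ.comp (Primrec.fst.comp Primrec.fst)) (Primrec.snd.comp Primrec.snd)
  · refine Primrec.eq.comp (primrec_map_lookupNode hn hφ
      (Primrec.snd.comp (Primrec.snd.comp (Primrec.snd.comp hd)))) ?_
    exact Primrec.list_cons.comp (Primrec.const 0)
      (Primrec.list_cons.comp hlen (Primrec.const []))

theorem primrecPred_isString (hd : Primrec d) (hw : Primrec w) :
    PrimrecPred fun a => (d a).IsString (w a) := by
  refine PrimrecPred.exists_mem (primrec_assignments (Primrec.fst.comp hd)
    (Primrec.succ.comp (Primrec.list_length.comp hw))) ?_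
  exact (primrecPred_respects (hd.comp Primrec.fst) Primrec.snd).and
    ((primrecPred_separates (hd.comp Primrec.fst) Primrec.snd).and
      (primrecPred_mapsToString (hd.comp Primrec.fst) (hw.comp Primrec.fst) Primrec.snd))

end

/-- Every quantifier is bounded: by `stepBound`, by a list of results of `t` steps, or by a list of
assignments. -/
theorem primrecPred_accepts :
    PrimrecPred fun x : GrammarCode × List ℕ => GrammarCode.Accepts x.1 x.2 := by
  have hts : Primrec fun x : GrammarCode × List ℕ => x.1.1 := Primrec.fst.comp Primrec.fst
  have has : Primrec fun x : GrammarCode × List ℕ => x.1.2.1 :=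
    Primrec.fst.comp (Primrec.snd.comp Primrec.fst)
  have hs : Primrec fun x : GrammarCode × List ℕ => x.1.2.2.1 :=
    Primrec.fst.comp (Primrec.snd.comp (Primrec.snd.comp Primrec.fst))
  have htabs : Primrec fun x : GrammarCode × List ℕ => x.1.2.2.2 :=
    Primrec.snd.comp (Primrec.snd.comp (Primrec.snd.comp Primrec.fst))
  refine PrimrecPred.and ?_ ?_
  · refine PrimrecPred.forall_mem Primrec.snd (PrimrecPred.and ?_ ?_)
    · exact Primrec.eq.comp ((Primrec.list_getD 0).comp (hts.comp Primrec.fst) Primrec.snd)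
        (Primrec.const 2)
    · exact PrimrecPred.mem_list Primrec.snd (has.comp Primrec.fst)
  · refine PrimrecPred.exists_lt_of (Primrec.succ.comp
      (primrec_stepBound hts (Primrec.list_length.comp Primrec.snd))) ?_
    refine PrimrecPred.exists_mem ?_ (primrecPred_isString Primrec.snd
      (Primrec.snd.comp (Primrec.fst.comp Primrec.fst)))
    refine primrec_steps (htabs.comp Primrec.fst) ?_ Primrec.snd
    have hk : Primrec fun x : (GrammarCode × List ℕ) × ℕ =>
        List.range (x.1.1.1.getD x.1.1.2.2.1 0) :=
      Primrec.list_range.comp (((Primrec.list_getD 0).comp hts hs).comp Primrec.fst)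
    refine Primrec.pair hk (Primrec.pair (Primrec.const []) (Primrec.pair ?_ hk))
    exact Primrec.list_cons.comp (Primrec.pair (hs.comp Primrec.fst) hk) (Primrec.const [])

/-! ### Recursive languages and diagonalisation -/

/-- Membership in string languages of grammars is decidable, uniformly in the grammar. -/
theorem exists_computable_membership :
    ∃ f : GrammarCode × List ℕ → Bool, Computable f ∧
      ∀ (C : Signature) (G : PHRGrammar C) (n : ℕ) (ν : C.Label ≃ Fin n) (c : GrammarCode),
        c.Describes ν G →
        ∀ w : List C.Label, f (c, w.map fun a => (ν a : ℕ)) = true ↔ w ∈ STR G.language := by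
  classical
  refine ⟨fun x => decide (GrammarCode.Accepts x.1 x.2), primrecPred_accepts.decide.to_comp, ?_⟩
  intro C G n ν c hc w
  rw [decide_eq_true_iff]
  exact GrammarCode.accepts_iff hc w

/-- Nonempty words are translated letter by letter into label numbers and passed to the uniform
procedure. -/
theorem phrs_subset_rec : PHRS ⊆ REC := by
  classical
  obtain ⟨f, hf, hfG⟩ := exists_computable_membership
  rintro L ⟨k, l, -, -, C, G, ι, -, -, hL⟩
  have := L.finite_alphabet
  have := C.finite_label
  obtain ⟨n, ⟨e⟩⟩ := Finite.exists_equiv_fin L.Alphabet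
  obtain ⟨m, ⟨ν⟩⟩ := Finite.exists_equiv_fin C.Label
  obtain ⟨c, hc⟩ := GrammarCode.exists_describes ν G
  refine ⟨n, e, ?_⟩
  let g : List (Fin n) → List ℕ := fun w => w.map fun i => (ν (ι (e.symm i)) : ℕ)
  have hg : Computable g := by
    refine Primrec.to_comp (Primrec.list_map Primrec.id ?_)
    exact (Primrec.dom_finite fun i : Fin n => (ν (ι (e.symm i)) : ℕ)).comp Primrec.snd
  have hmem : ∀ w : List (Fin n), f (c, g w) = true ↔
      w.map e.symm ∈ L.lang ∧ w.map e.symm ≠ [] := by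
    intro w
    have h := hfG C G m ν c hc ((w.map e.symm).map ι)
    rw [hL, List.map_map, List.map_map] at h
    refine h.trans ?_
    rw [(List.map_injective_iff.2 ι.injective).mem_set_image]
    rfl
  -- The grammar says nothing about the empty word; its membership is a single bit, fixed in
  -- advance.
  have hcomp : Computable fun w : List (Fin n) =>
      bif decide (w = []) then decide (([] : List L.Alphabet) ∈ L.lang) else f (c, g w) := by
    refine Computable.cond ?_ (Computable.const _)
      (hf.comp (Computable.pair (Computable.const c) hg))
    exact (Primrec.eq.comp Primrec.id (Primrec.const [])).decide.to_comp
  refine ComputablePred.computable_iff.2 ⟨_, hcomp, funext fun w => propext ?_⟩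
  rcases eq_or_ne w [] with rfl | hw
  · simp
  · simp only [hw, decide_false, cond_false, hmem]
    simp [hw]

theorem computable_diagonal {α : Type*} [Primcodable α] {f : α × List ℕ → Bool}
    (hf : Computable f) :
    Computable fun k : ℕ => ((Encodable.decode k : Option (α × ℕ)).map fun p =>
      !f (p.1, List.replicate (k + 1) p.2)).getD false := by
  have hrep : Primrec fun x : ℕ × ℕ => List.replicate (x.1 + 1) x.2 := by
    refine (Primrec.list_map (f := fun x : ℕ × ℕ => List.range (x.1 + 1))
      (g := fun x _ => x.2) (Primrec.list_range.comp (Primrec.succ.comp Primrec.fst))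
      (Primrec.snd.comp Primrec.fst)).of_eq fun x => ?_
    simp
  refine Computable.option_getD (Computable.option_map Computable.decode ?_) (Computable.const _)
  refine Primrec.not.to_comp.comp (hf.comp (Computable.pair ?_ (hrep.to_comp.comp
    (Computable.pair ?_ ?_))))
  · exact Computable.fst.comp Computable.snd
  · exact Computable.fst
  · exact Computable.snd.comp Computable.snd

/-- A recursive language that differs from the language of every grammar. -/
theorem exists_mem_rec_notMem_phrs : ∃ L ∈ REC, L ∉ PHRS := by
  obtain ⟨f, hf, hfG⟩ := exists_computable_membership
  -- A code `k` names a grammar together with the label number standing for the only letter, because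
  -- the embedding of the alphabet is not part of the grammar's data.
  let D : ℕ → Prop := fun k => ∃ p : GrammarCode × ℕ, Encodable.decode k = some p ∧
    f (p.1, List.replicate (k + 1) p.2) = false
  let g : ℕ → Bool := fun k => ((Encodable.decode k : Option (GrammarCode × ℕ)).map fun p =>
    !f (p.1, List.replicate (k + 1) p.2)).getD false
  have hgD : ∀ k, g k = true ↔ D k := by
    intro k
    simp only [g, D]
    cases (Encodable.decode k : Option (GrammarCode × ℕ)) <;> simp
  have hg : Computable g := computable_diagonal hf
  -- Code `k` is tested on the word of length `k + 1`, so the diagonal word is never empty. The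
  -- empty word shares the answer of `k = 0`, which does not matter.
  let L : StringLanguage := ⟨Unit, inferInstance, {w | D (w.length - 1)}⟩
  refine ⟨L, ⟨1, Equiv.ofUnique Unit (Fin 1), ?_⟩, ?_⟩
  · have : Computable fun w : List (Fin 1) => g (w.length - 1) :=
      hg.comp (Primrec.pred.comp Primrec.list_length).to_comp
    refine ComputablePred.computable_iff.2 ⟨_, this, funext fun w => propext ?_⟩
    rw [hgD]
    change D _ ↔ _
    rw [List.length_map]
  · rintro ⟨k, l, -, -, C, G, ι, -, -, hL⟩
    have := C.finite_label
    obtain ⟨m, ⟨ν⟩⟩ := Finite.exists_equiv_fin C.Label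
    obtain ⟨c, hc⟩ := GrammarCode.exists_describes ν G
    let p : GrammarCode × ℕ := (c, ν (ι ()))
    let N := Encodable.encode p
    have h := hfG C G m ν c hc ((List.replicate (N + 1) ()).map ι)
    rw [hL, (List.map_injective_iff.2 ι.injective).mem_set_image, List.map_map] at h
    have hw : (List.replicate (N + 1) ()).map ((fun a => (ν a : ℕ)) ∘ ι) =
        List.replicate (N + 1) p.2 := List.map_replicate
    rw [hw] at h
    have hD : List.replicate (N + 1) () ∈ L.lang ↔ f (p.1, List.replicate (N + 1) p.2) = false := by
      change D _ ↔ _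
      simp only [D, List.length_replicate, Nat.add_sub_cancel, N, Encodable.encodek,
        Option.some.injEq, exists_eq_left']
    -- On its own diagonal word, the grammar would have to accept exactly if it rejects.
    have h' : f (p.1, List.replicate (N + 1) p.2) = true ↔
        f (p.1, List.replicate (N + 1) p.2) = false := by
      refine h.trans ((and_iff_left ?_).trans hD)
      simp
    cases hb : f (p.1, List.replicate (N + 1) p.2) <;> simp [hb] at h'

theorem mainTheorem11 :
    (∃ f : GrammarCode × List ℕ → Bool, Computable f ∧
      ∀ (C : Signature) (G : PHRGrammar C) (n : ℕ) (ν : C.Label ≃ Fin n) (c : GrammarCode),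
        c.Describes ν G → IsStringGraphLanguage G.language →
        ∀ w : List C.Label, f (c, w.map fun a => (ν a : ℕ)) = true ↔ w ∈ STR G.language) ∧
    PHRS ⊂ REC := by
  refine ⟨?_, phrs_subset_rec, ?_⟩
  · obtain ⟨f, hf, h⟩ := exists_computable_membership
    exact ⟨f, hf, fun C G n ν c hc _ => h C G n ν c hc⟩
  · obtain ⟨L, h1, h2⟩ := exists_mem_rec_notMem_phrs
    exact fun h => h2 (h h1)
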